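/- A \emph{connected map} is a finite connected graph (loops and multiple edges allowed; a single vertex without edges is allowed) embedded in a closed connected oriented surface so that every component of the complement (every \emph{face}) is homeomorphic to an open disc; its genus is the genus of that surface. A \emph{map} $M$ is a finite disjoint union of connected maps, each in its own surface; it is given combinatorially by its finite underlying graph $(V,E)$ together with, at each vertex, the anticlockwise cyclic order of the edge-ends at that vertex (an isolated vertex is a connected map in the sphere with one face). Let $v(M),e(M),f(M),k(M)$ be the numbers of vertices, edges, faces and connected components of $M$; the genus $g(M_i)$ of a connected component $M_i$ satisfies $v(M_i)-e(M_i)+f(M_i)=2-2g(M_i)$. Put $$n(M)=e(M)-v(M)+k(M),\qquad n^*(M)=e(M)-f(M)+k(M).$$ For $A\subseteq E$ let $A^c=E\setminus A$. The map $M\backslash A$ is obtained by deleting the edges in $A$ (keeping all vertices, and the induced cyclic orders on the remaining edge-ends), and the map $M/A$, obtained by contracting the edges in $A$, is defined by $(M/A)^*=M^*\backslash A$, where $^*$ is the surface dual and the edges of $M^*$ are identified with those of $M$. The \emph{surface Tutte polynomial} of $M$, in commuting indeterminates $\mathbf x=(x,x_0,x_1,x_2,\dots)$ and $\mathbf y=(y,y_0,y_1,y_2,\dots)$,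 is $$\mathcal T(M;\mathbf x,\mathbf y)=\sum_{A\subseteq E}x^{n^*(M/A)}\,y^{n(M\backslash A^c)}\prod_{M_i}x_{g(M_i)}\prod_{M_j}y_{g(M_j)},$$ where $M_i$ runs over the connected components of $M/A$ and $M_j$ over the connected components of $M\backslash A^c$. Let $G$ be a finite group and orient the edges of $M$ arbitrarily. A \emph{nowhere-identity local $G$-tension} of $M$ is an assignment of non-identity elements of $G$ to the edges of $M$ such that, for each face, the product of the elements on the edges around the face, taken in anticlockwise cyclic order and with values on backward edges inverted, is the identity. A \emph{nowhere-identity local $G$-flow} of $M$ is an assignment of non-identity elements of $G$ to the edges of $M$ such that, for each vertex, the product of the elements on the edges around the vertex, taken in anticlockwise cyclic order and with values on incoming edges inverted, is the identity. (An edge that occurs twice around a face or a vertex contributes twice.) \textbf{Theorem.} Let $M$ be a map, and let $G$ be a finite group whose irreducible representations over $\mathbb C$, one from each isomorphism class, have dimensions $n_1,\dots,n_\ell$. Then the number of nowhere-identity local $G$-tensions of $M$ is $$(-1)^{e(M)-f(M)}\,\mathcal T(M;\mathbf x,\mathbf y)\quad\text{with}\quad x=-|G|,\ y=1,\ x_g=-\frac1{|G|}\sum_{i=1}^{\ell}n_i^{2-2g},\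 y_g=1\quad(g=0,1,2,\dots),$$ and the number of nowhere-identity local $G$-flows of $M$ is $$(-1)^{e(M)-v(M)}\,\mathcal T(M;\mathbf x,\mathbf y)\quad\text{with}\quad x=1,\ y=-|G|,\ x_g=1,\ y_g=-\frac1{|G|}\sum_{i=1}^{\ell}n_i^{2-2g}\quad(g=0,1,2,\dots).$$ -/

import Mathlib

/-! ### First-return permutations -/

section FirstReturn

variable {α : Type*} [Finite α]

theorem exists_pos_iterate_mem (p : Equiv.Perm α) (S : Set α) (x : S) :
    ∃ n : ℕ, 0 < n ∧ p^[n] x.1 ∈ S := by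
  refine ⟨orderOf p, orderOf_pos p, ?_⟩
  rw [Equiv.Perm.iterate_eq_pow, pow_orderOf_eq_one]
  exact x.2

open Classical in
/-- The least `n > 0` such that `p^[n] x` lies in `S`. -/
noncomputable def returnTime (p : Equiv.Perm α) (S : Set α) (x : S) : ℕ :=
  Nat.find (exists_pos_iterate_mem p S x)

theorem returnTime_pos (p : Equiv.Perm α) (S : Set α) (x : S) : 0 < returnTime p S x := by
  classical
  exact (Nat.find_spec (exists_pos_iterate_mem p S x)).1

theorem returnTime_mem (p : Equiv.Perm α) (S : Set α) (x : S) :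
    p^[returnTime p S x] x.1 ∈ S := by
  classical
  exact (Nat.find_spec (exists_pos_iterate_mem p S x)).2

theorem returnTime_le (p : Equiv.Perm α) (S : Set α) (x : S) {n : ℕ} (hn : 0 < n)
    (h : p^[n] x.1 ∈ S) : returnTime p S x ≤ n := by
  classical
  exact Nat.find_min' (exists_pos_iterate_mem p S x) ⟨hn, h⟩

/-- The first point of `S` met after `x` when `p` is applied repeatedly to `x`. -/
noncomputable def firstReturnFun (p : Equiv.Perm α) (S : Set α) (x : S) : S :=
  ⟨p^[returnTime p S x] x.1, returnTime_mem p S x⟩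

theorem firstReturnFun_injective (p : Equiv.Perm α) (S : Set α) :
    Function.Injective (firstReturnFun p S) := by
  have key : ∀ x y : S, firstReturnFun p S x = firstReturnFun p S y →
      returnTime p S x ≤ returnTime p S y → x = y := by
    intro x y h hle
    have h' : p^[returnTime p S x] x.1 = p^[returnTime p S y] y.1 := congrArg Subtype.val h
    obtain ⟨k, hk⟩ := Nat.exists_eq_add_of_le hle
    rw [hk, Function.iterate_add_apply] at h'
    have h2 : x.1 = p^[k] y.1 := (p.injective.iterate _) h'
    rcases Nat.eq_zero_or_pos k with h0 | h0
    · subst h0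
      exact Subtype.ext h2
    · have h3 : returnTime p S y ≤ k := returnTime_le p S y h0 (h2 ▸ x.2)
      have := returnTime_pos p S x
      omega
  intro x y h
  rcases le_total (returnTime p S x) (returnTime p S y) with hle | hle
  · exact key x y h hle
  · exact (key y x h.symm hle).symm

/-- The permutation of `S` induced by `p`: the cycles of `p`, with the points outside `S`
skipped. -/
noncomputable def firstReturn (p : Equiv.Perm α) (S : Set α) : Equiv.Perm S :=
  Equiv.ofBijective (firstReturnFun p S)
    (Finite.injective_iff_bijective.mp (firstReturnFun_injective p S))

theorem firstReturn_apply (p : Equiv.Perm α) (S : Set α) (x : S) :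
    (firstReturn p S x : α) = p^[returnTime p S x] x.1 := rfl

theorem firstReturn_sameCycle_iff (p : Equiv.Perm α) (S : Set α) (x y : S) :
    (firstReturn p S).SameCycle x y ↔ p.SameCycle x.1 y.1 := by
  constructor
  · intro h
    obtain ⟨n, rfl⟩ := h.exists_nat_pow_eq
    clear h
    induction n with
    | zero => exact Equiv.Perm.SameCycle.refl _ _
    | succ n ih =>
      refine ih.trans ?_
      rw [pow_succ', Equiv.Perm.mul_apply, firstReturn_apply, Equiv.Perm.iterate_eq_pow]
      exact ⟨(returnTime p S ((firstReturn p S ^ n) x) : ℤ), by rw [zpow_natCast]⟩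
  · intro h
    obtain ⟨n, hn⟩ := h.exists_nat_pow_eq
    clear h
    induction n using Nat.strong_induction_on generalizing x with
    | _ n ih =>
      rcases Nat.eq_zero_or_pos n with h0 | h0
      · subst h0
        have : x = y := Subtype.ext hn
        rw [this]
      · have hle : returnTime p S x ≤ n :=
          returnTime_le p S x h0 (by rw [Equiv.Perm.iterate_eq_pow, hn]; exact y.2)
        have hpos := returnTime_pos p S x
        have h1 : (firstReturn p S).SameCycle x (firstReturn p S x) := ⟨1, by simp⟩
        refine h1.trans (ih (n - returnTime p S x) (by omega) _ ?_)
        rw [firstReturn_apply, Equiv.Perm.iterate_eq_pow, ← Equiv.Perm.mul_apply, ← pow_add,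
          Nat.sub_add_cancel hle, hn]

end FirstReturn

/-! ### Maps -/

/-- A map (orientably embedded graph), given by its rotation system.  The underlying graph has
vertex set `V` and edge set `E`; loops, multiple edges, isolated vertices and several connected
components are allowed.  Each edge `e` has two ends, the darts `(e, true)` and `(e, false)`, and
`vert d` is the vertex at which the dart `d` starts.  `rot d` is the dart that follows `d` in the
anticlockwise order around `vert d`; thus the darts at a vertex form one cycle of `rot`. -/
structure SurfaceMap (V E : Type*) where
  rot : Equiv.Perm (E × Bool)
  vert : E × Bool → V
  vert_eq_iff : ∀ d d' : E × Bool, vert d = vert d' ↔ rot.SameCycle d d'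

/-- The involution that exchanges the two darts of each edge. -/
def dartFlip (E : Type*) : Equiv.Perm (E × Bool) :=
  Equiv.prodCongr (Equiv.refl E) Equiv.boolNot

namespace SurfaceMap

variable {V E : Type*}

/-- Face tracing: move along the dart `d` to its other end, and there take the dart preceding the
reversed dart in the anticlockwise order.  This walks around the face to the left of `d`, in the
anticlockwise direction. -/
def faceRot (M : SurfaceMap V E) : Equiv.Perm (E × Bool) :=
  M.rot⁻¹ * dartFlip E

/-- The faces of `M`: the orbits of face tracing, and one face for each isolated vertex (an isolated
vertex is a connected component of its own, embedded in its own sphere). -/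
abbrev Face (M : SurfaceMap V E) : Type _ :=
  Quotient (Equiv.Perm.SameCycle.setoid M.faceRot) ⊕ {v : V // ∀ d, M.vert d ≠ v}

/-- The surface dual.  The dual dart of `d` starts in the face to the left of `d` and crosses `d`
from left to right. -/
def dual (M : SurfaceMap V E) : SurfaceMap M.Face E where
  rot := M.faceRot
  vert d := Sum.inl (Quotient.mk (Equiv.Perm.SameCycle.setoid M.faceRot) d)
  vert_eq_iff d d' := by
    exact Sum.inl_injective.eq_iff.trans Quotient.eq

/-- Deletion of the edges in `B`: the darts of `B` are skipped in the rotations; all vertices are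
kept. -/
noncomputable def delete [Finite E] (M : SurfaceMap V E) (B : Set E) :
    SurfaceMap V {e : E // e ∉ B} where
  rot := (Equiv.prodSubtypeFstEquivSubtypeProd (p := fun e : E => e ∉ B)).permCongr
    (firstReturn M.rot {d : E × Bool | d.1 ∉ B})
  vert d := M.vert (d.1.1, d.2)
  vert_eq_iff d d' := by
    rw [M.vert_eq_iff]
    have h := firstReturn_sameCycle_iff M.rot {d : E × Bool | d.1 ∉ B}
      ⟨(d.1.1, d.2), d.1.2⟩ ⟨(d'.1.1, d'.2), d'.1.2⟩
    refine h.symm.trans ?_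
    refine (exists_congr fun i => ?_)
    rw [← Equiv.permCongrHom_coe, ← map_zpow, Equiv.permCongrHom_coe, Equiv.permCongr_apply]
    exact Equiv.eq_symm_apply (Equiv.prodSubtypeFstEquivSubtypeProd (p := fun e : E => e ∉ B))
      (x := d') (y := (firstReturn M.rot {d : E × Bool | d.1 ∉ B} ^ i)
        ⟨(d.1.1, d.2), d.1.2⟩)

/-- Contraction of the edges in `B`, by duality: `(M / B)* = M* \ B`. -/
noncomputable def contract [Finite E] (M : SurfaceMap V E) (B : Set E) :
    SurfaceMap (M.dual.delete B).Face {e : E // e ∉ B} :=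
  (M.dual.delete B).dual

/-! ### Parameters of maps -/

/-- The connected components of the underlying graph, as classes of vertices for the equivalence
relation generated by adjacency. -/
def Component (M : SurfaceMap V E) : Type _ :=
  Quot fun u v : V => ∃ e : E, u = M.vert (e, true) ∧ v = M.vert (e, false)

/-- The connected component of a vertex. -/
def comp (M : SurfaceMap V E) (v : V) : M.Component := Quot.mk _ v

instance (M : SurfaceMap V E) [Finite V] : Finite M.Component :=
  inferInstanceAs (Finite (Quot _))

noncomputable instance (M : SurfaceMap V E) [Finite V] : Fintype M.Component :=
  Fintype.ofFinite _

theorem comp_vert_dartFlip (M : SurfaceMap V E) (d : E × Bool) :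
    M.comp (M.vert (dartFlip E d)) = M.comp (M.vert d) := by
  obtain ⟨e, b⟩ := d
  have h : M.comp (M.vert (e, true)) = M.comp (M.vert (e, false)) := Quot.sound ⟨e, rfl, rfl⟩
  cases b
  · exact h
  · exact h.symm

theorem comp_vert_faceRot (M : SurfaceMap V E) (d : E × Bool) :
    M.comp (M.vert (M.faceRot d)) = M.comp (M.vert d) := by
  rw [← M.comp_vert_dartFlip d]
  congr 1
  rw [M.vert_eq_iff]
  exact ⟨1, by simp [faceRot]⟩

theorem comp_vert_eq_of_sameCycle (M : SurfaceMap V E) (d d' : E × Bool)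
    (h : M.faceRot.SameCycle d d') : M.comp (M.vert d) = M.comp (M.vert d') := by
  obtain ⟨i, rfl⟩ := h
  induction i using Int.induction_on with
  | zero => rfl
  | succ i ih => rw [add_comm, zpow_add, zpow_one, Equiv.Perm.mul_apply, comp_vert_faceRot, ih]
  | pred i ih =>
    rw [ih, ← M.comp_vert_faceRot ((M.faceRot ^ (-(i : ℤ) - 1)) d), ← Equiv.Perm.mul_apply,
      ← zpow_one_add, add_sub_cancel]

/-- The connected component in which a face lies. -/
def faceComp (M : SurfaceMap V E) : M.Face → M.Component :=
  Sum.elim (Quotient.lift (fun d => M.comp (M.vert d)) (M.comp_vert_eq_of_sameCycle))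
    (fun v => M.comp v.1)

/-- `v(M)`. -/
noncomputable def numVertices (_M : SurfaceMap V E) : ℕ := Nat.card V

/-- `e(M)`. -/
noncomputable def numEdges (_M : SurfaceMap V E) : ℕ := Nat.card E

/-- `f(M)`. -/
noncomputable def numFaces (M : SurfaceMap V E) : ℕ := Nat.card M.Face

/-- `k(M)`. -/
noncomputable def numComponents (M : SurfaceMap V E) : ℕ := Nat.card M.Component

/-- The nullity `n(M) = e(M) - v(M) + k(M)` (a natural number, as `v(M) ≤ e(M) + k(M)`). -/
noncomputable def nullity (M : SurfaceMap V E) : ℕ :=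
  M.numEdges + M.numComponents - M.numVertices

/-- The dual nullity `n*(M) = e(M) - f(M) + k(M)` (a natural number, as `f(M) ≤ e(M) + k(M)`). -/
noncomputable def dualNullity (M : SurfaceMap V E) : ℕ :=
  M.numEdges + M.numComponents - M.numFaces

/-- The Euler characteristic of a connected component: vertices minus edges plus faces. -/
noncomputable def eulerChar (M : SurfaceMap V E) (C : M.Component) : ℤ :=
  (Nat.card {v : V // M.comp v = C} : ℤ) -
    (Nat.card {e : E // M.comp (M.vert (e, true)) = C} : ℤ) +
    (Nat.card {F : M.Face // M.faceComp F = C} : ℤ)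

/-- The genus `g` of (the surface of) a connected component, from Euler's formula
`χ = 2 - 2 g`. -/
noncomputable def genus (M : SurfaceMap V E) (C : M.Component) : ℕ :=
  ((2 - M.eulerChar C) / 2).toNat

end SurfaceMap

/-! ### The surface Tutte polynomial -/

/-- The indeterminates `x`, `y`, `x_g`, `y_g` (`g = 0, 1, 2, …`). -/
inductive TutteVar
  | x
  | y
  | xg (g : ℕ)
  | yg (g : ℕ)

namespace SurfaceMap

variable {V E : Type*}

/-- The surface Tutte polynomial: the sum over `A ⊆ E` of
`x ^ n*(M / A) * y ^ n(M \ Aᶜ)` times the product of `x_{g(M_i)}` over the components `M_i` of `M / A`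
times the product of `y_{g(M_j)}` over the components `M_j` of `M \ Aᶜ`. -/
noncomputable def surfaceTutte [Finite V] [Fintype E] (M : SurfaceMap V E) :
    MvPolynomial TutteVar ℤ :=
  ∑ A : Finset E,
    MvPolynomial.X TutteVar.x ^ (M.contract (A : Set E)).dualNullity *
    MvPolynomial.X TutteVar.y ^ (M.delete (A : Set E)ᶜ).nullity *
    (∏ C : (M.contract (A : Set E)).Component,
      MvPolynomial.X (TutteVar.xg ((M.contract (A : Set E)).genus C))) *
    (∏ C : (M.delete (A : Set E)ᶜ).Component,
      MvPolynomial.X (TutteVar.yg ((M.delete (A : Set E)ᶜ).genus C)))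

end SurfaceMap

/-- The point at which the surface Tutte polynomial is evaluated: `x`, `y`, `x_g`, `y_g` take the
values `a`, `b`, `s g`, `t g`. -/
def tuttePoint {R : Type*} (a b : R) (s t : ℕ → R) : TutteVar → R
  | TutteVar.x => a
  | TutteVar.y => b
  | TutteVar.xg g => s g
  | TutteVar.yg g => t g

/-! ### Local flows and local tensions -/

/-- For an assignment `w` of group elements to the edges, oriented so that the edge `e` points from
the start of the dart `(e, o e)` to its other end: the value met when the dart `d` is traversed from
its start, namely `w e` if `d` agrees with the orientation of its edge `e`, and `(w e)⁻¹` if not. -/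
def dartValue {E G : Type*} [Group G] (o : E → Bool) (w : E → G) (d : E × Bool) : G :=
  if d.2 = o d.1 then w d.1 else (w d.1)⁻¹

/-- The product `f d * f (p d) * f (p (p d)) * ⋯`, once around the cycle of `p` through `d`. -/
noncomputable def cycleProd {α G : Type*} [Group G] (p : Equiv.Perm α) (f : α → G) (d : α) : G :=
  ((List.range (Function.minimalPeriod p d)).map fun i => f (p^[i] d)).prod

namespace SurfaceMap

variable {V E G : Type*} [Group G]

/-- Local `G`-flows: around each vertex, in anticlockwise order and starting from any of its darts,
the values, inverted on incoming edges, have product `1`. -/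
def IsLocalFlow (M : SurfaceMap V E) (o : E → Bool) (w : E → G) : Prop :=
  ∀ d : E × Bool, cycleProd M.rot (dartValue o w) d = 1

/-- Local `G`-tensions: around each face, in anticlockwise order and starting from any of its darts,
the values, inverted on backward edges, have product `1`. -/
def IsLocalTension (M : SurfaceMap V E) (o : E → Bool) (w : E → G) : Prop :=
  ∀ d : E × Bool, cycleProd M.faceRot (dartValue o w) d = 1

/-- The number of nowhere-identity local `G`-flows. -/
noncomputable def numNowhereIdentityFlows (M : SurfaceMap V E) (o : E → Bool)
    (G : Type*) [Group G] : ℕ :=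
  Nat.card {w : E → G // M.IsLocalFlow o w ∧ ∀ e, w e ≠ 1}

/-- The number of nowhere-identity local `G`-tensions. -/
noncomputable def numNowhereIdentityTensions (M : SurfaceMap V E) (o : E → Bool)
    (G : Type*) [Group G] : ℕ :=
  Nat.card {w : E → G // M.IsLocalTension o w ∧ ∀ e, w e ≠ 1}

end SurfaceMap

/-! ### Dimensions of irreducible representations -/

/-- `ρ 0, …, ρ (ℓ - 1)`, of dimensions `n 0, …, n (ℓ - 1)`, are the complex irreducible
representations of `G`, each isomorphism class being listed exactly once. -/
structure IsIrrepList (G : Type*) [Group G] {ℓ : ℕ} (n : Fin ℓ → ℕ)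
    (ρ : ∀ i, Representation ℂ G (Fin (n i) → ℂ)) : Prop where
  irreducible : ∀ i, (ρ i).IsIrreducible
  distinct : ∀ i j, Nonempty ((ρ i).Equiv (ρ j)) → i = j
  complete : ∀ (m : ℕ) (τ : Representation ℂ G (Fin m → ℂ)), τ.IsIrreducible →
    ∃ i, Nonempty (τ.Equiv (ρ i))

/-! The heart is a count of all local flows, identity values allowed: their number is
$|G|^{e-v}\prod_C\sum_i n_i^{\chi(C)}$, with $C$ running over the components
(`card_isLocalFlow_eq_prod`). The condition at a vertex is detected by $\sum_i
n_i\,\mathrm{tr}\,\rho_i(g)=|G|\,[g=1]$. Each trace of a product around a vertex is expanded into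
matrix entries, which puts an index on every dart. With the indices fixed, the sum over assignments
factors over the edges, and at each edge Schur orthogonality gives $|G|/n_i$ or $0$. The surviving
labellings are constant along faces, and their irreducible is constant on each component. So a
component carrying irreducible $i$ receives $n_i$ from each vertex (the weight), $|G|/n_i$ from each
edge and $n_i$ from each face (the choice of index): in all $n_i^{\chi(C)}$, up to powers of $|G|$.

Deleting edges amounts to giving them the value $1$, so inclusion and exclusion over the set $B$ of
edges with value $1$ counts the nowhere-identity flows as an alternating sum over the maps
$M\backslash B$. Since $n(M\backslash B)-k(M\backslash B)=e-|B|-v$, the signs and powers of $|G|$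
combine into the stated evaluation, with $B=A^c$.

Genus and nullity are defined by truncated operations, so it must be proved that $\chi(C)$ is even
and at most $2$ (`even_eulerChar_and_le`): parity comes from signs of permutations, the bound from a
dimension count.

Tensions of $M$ are flows of $M^*$. Duality preserves components and genus and exchanges $n$ with
$n^*$, which turns the flow formula for $M^*$ into the tension formula for $M$. -/

/-! ### Schur orthogonality -/

section Irreps

open scoped MonoidAlgebra

variable {G : Type*} [Group G]

variable {ℓ : ℕ} {n : Fin ℓ → ℕ}

/-- The block diagonal matrices whose blocks are the matrices of the representations `ρ i`. -/
noncomputable def blockMatrix (ρ : ∀ i, Representation ℂ G (Fin (n i) → ℂ)) :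
    G →* Matrix (Σ i, Fin (n i)) (Σ i, Fin (n i)) ℂ where
  toFun g := Matrix.blockDiagonal' fun i => LinearMap.toMatrix' (ρ i g)
  map_one' := by
    simp only [map_one, LinearMap.toMatrix'_one]
    exact Matrix.blockDiagonal'_one
  map_mul' g h := by
    rw [← Matrix.blockDiagonal'_mul]
    simp [LinearMap.toMatrix'_mul]

theorem blockMatrix_apply_of_ne (ρ : ∀ i, Representation ℂ G (Fin (n i) → ℂ)) (g : G)
    {a b : Σ i, Fin (n i)} (h : a.1 ≠ b.1) : blockMatrix ρ g a b = 0 := by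
  obtain ⟨i, a⟩ := a
  obtain ⟨j, b⟩ := b
  exact Matrix.blockDiagonal'_apply_ne (fun i => LinearMap.toMatrix' (ρ i g)) a b h

theorem blockMatrix_apply_eq (ρ : ∀ i, Representation ℂ G (Fin (n i) → ℂ)) (g : G)
    (i : Fin ℓ) (a b : Fin (n i)) :
    blockMatrix ρ g ⟨i, a⟩ ⟨i, b⟩ = LinearMap.toMatrix' (ρ i g) a b :=
  Matrix.blockDiagonal'_apply_eq (fun i => LinearMap.toMatrix' (ρ i g)) i a b

variable {ρ : ∀ i, Representation ℂ G (Fin (n i) → ℂ)}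

theorem IsIrrepList.dim_pos (hρ : IsIrrepList G n ρ) (i : Fin ℓ) : 0 < n i := by
  by_contra h
  have h0 : n i = 0 := by omega
  have : IsEmpty (Fin (n i)) := by rw [h0]; infer_instance
  have hn : Nontrivial (Subrepresentation (ρ i)) := (hρ.irreducible i).toNontrivial
  obtain ⟨p, q, hpq⟩ := hn
  exact hpq (Subrepresentation.toSubmodule_injective (Subsingleton.elim _ _))

/-- The average of a linear map over `G`, as an intertwining map. -/
def averageIntertwining [Fintype G] {V W : Type*} [AddCommGroup V] [Module ℂ V]
    [AddCommGroup W] [Module ℂ W] (σ : Representation ℂ G V) (τ : Representation ℂ G W)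
    (X : V →ₗ[ℂ] W) : σ.IntertwiningMap τ where
  toLinearMap := ∑ g, τ g ∘ₗ X ∘ₗ σ g⁻¹
  isIntertwining' h := by
    ext v
    simp only [LinearMap.comp_apply, LinearMap.sum_apply, map_sum]
    refine Fintype.sum_equiv (Equiv.mulLeft h⁻¹) _ _ fun g => ?_
    simp only [Equiv.coe_mulLeft, mul_inv_rev, inv_inv, map_mul, Module.End.mul_apply]
    rw [← Module.End.mul_apply (τ h), ← map_mul, mul_inv_cancel, map_one, Module.End.one_apply]

/-- Averaging a matrix unit produces exactly the sums of products of matrix coefficients, so Schur's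
lemma on intertwining maps becomes orthogonality. -/
theorem toMatrix'_averageIntertwining_single [Fintype G] {m k : ℕ}
    (σ : Representation ℂ G (Fin m → ℂ)) (τ : Representation ℂ G (Fin k → ℂ))
    (a b : Fin k) (c d : Fin m) :
    LinearMap.toMatrix' (averageIntertwining σ τ
      (Matrix.toLin' (Matrix.single b c 1))).toLinearMap a d =
      ∑ g, LinearMap.toMatrix' (τ g) a b * LinearMap.toMatrix' (σ g⁻¹) c d := by
  simp only [averageIntertwining, map_sum, Matrix.sum_apply, LinearMap.toMatrix'_comp,
    LinearMap.toMatrix'_toLin', ← Matrix.mul_assoc]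
  refine Finset.sum_congr rfl fun g _ => ?_
  rw [Matrix.mul_apply, Finset.sum_eq_single c]
  · simp
  · intro x _ hx
    rw [Matrix.mul_single_apply_of_ne _ _ _ _ _ hx, zero_mul]
  · simp

/-- Schur orthogonality of the matrix coefficients. -/
theorem IsIrrepList.sum_blockMatrix_mul [Fintype G] (hρ : IsIrrepList G n ρ)
    (a b c d : Σ i, Fin (n i)) :
    ∑ g, blockMatrix ρ g a b * blockMatrix ρ g⁻¹ c d =
      if a = d ∧ b = c ∧ a.1 = b.1 then (Fintype.card G : ℂ) / n a.1 else 0 := by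
  by_cases hab : a.1 = b.1
  swap
  · simp [blockMatrix_apply_of_ne ρ _ hab, hab]
  by_cases hcd : c.1 = d.1
  swap
  · rw [if_neg (by rintro ⟨rfl, rfl, h⟩; exact hcd h.symm)]
    simp [blockMatrix_apply_of_ne ρ _ hcd]
  obtain ⟨i, a⟩ := a
  obtain ⟨_, b⟩ := b
  obtain ⟨j, c⟩ := c
  obtain ⟨_, d⟩ := d
  obtain rfl : i = _ := hab
  obtain rfl : j = _ := hcd
  simp only [blockMatrix_apply_eq, ← toMatrix'_averageIntertwining_single]
  have := hρ.irreducible i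
  have := hρ.irreducible j
  by_cases hij : i = j
  swap
  · rw [if_neg (by rintro ⟨h, -⟩; exact hij (congrArg Sigma.fst h))]
    have : IsEmpty ((ρ j).Equiv (ρ i)) := ⟨fun e => hij (hρ.distinct j i ⟨e⟩).symm⟩
    -- Schur's lemma: between non-isomorphic irreducibles the only intertwining map is zero.
    rw [Subsingleton.elim (averageIntertwining (ρ j) (ρ i) _) 0]
    simp
  subst hij
  obtain ⟨z, hz⟩ :=
    (Representation.IsIrreducible.algebraMap_intertwiningMap_bijective_of_isAlgClosed
      (ρ := ρ i)).2 (averageIntertwining (ρ i) (ρ i) (Matrix.toLin' (Matrix.single b c 1)))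
  have hz' : ∀ a d, ∑ g, LinearMap.toMatrix' (ρ i g) a b * LinearMap.toMatrix' (ρ i g⁻¹) c d =
      if a = d then z else 0 := by
    intro a d
    rw [← toMatrix'_averageIntertwining_single, ← hz]
    have h1 : (algebraMap ℂ ((ρ i).IntertwiningMap (ρ i)) z).toLinearMap =
        z • (1 : Module.End ℂ (Fin (n i) → ℂ)) := rfl
    rw [h1, map_smul, LinearMap.toMatrix'_one, Matrix.smul_apply, Matrix.one_apply]
    simp
  -- Taking the trace (setting `d = a` and summing) determines the scalar `z`.
  have htr : (n i : ℂ) * z = if b = c then (Fintype.card G : ℂ) else 0 := by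
    calc (n i : ℂ) * z = ∑ a, ∑ g, LinearMap.toMatrix' (ρ i g) a b *
          LinearMap.toMatrix' (ρ i g⁻¹) c a := by
          simp only [hz', if_true]
          simp
      _ = ∑ g, (LinearMap.toMatrix' (ρ i g⁻¹) * LinearMap.toMatrix' (ρ i g)) c b := by
        rw [Finset.sum_comm]
        simp only [Matrix.mul_apply, mul_comm]
      _ = _ := by
        simp only [← LinearMap.toMatrix'_mul, ← map_mul, inv_mul_cancel, map_one,
          LinearMap.toMatrix'_one, Matrix.one_apply, eq_comm (a := c)]
        split_ifs <;> simp
  have hn : (n i : ℂ) ≠ 0 := Nat.cast_ne_zero.mpr (hρ.dim_pos i).ne'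
  rw [toMatrix'_averageIntertwining_single, hz']
  have hz2 : z = (if b = c then (Fintype.card G : ℂ) else 0) / n i := by
    rw [← htr]; field_simp
  simp only [hz2, Sigma.mk.injEq, heq_eq_eq, true_and, and_true]
  split_ifs <;> simp_all

/-- The group algebra is semisimple, so `1` is a sum of elements of simple left ideals. Each such
ideal is isomorphic to some `ρ i`, hence is killed by `D`, and `D = D * 1 = 0`. -/
theorem IsIrrepList.asAlgebraHom_injective [Finite G] (hρ : IsIrrepList G n ρ) (D : ℂ[G])
    (hD : ∀ i, (ρ i).asAlgebraHom D = 0) : D = 0 := by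
  have key : ∀ m : Submodule ℂ[G] ℂ[G], IsSimpleModule ℂ[G] m → ∀ x ∈ m, D * x = 0 := by
    intro m hm x hx
    have : Module.Finite ℂ m := Module.Finite.of_injective (m.subtype.restrictScalars ℂ)
      m.injective_subtype
    -- `complete` speaks only of representations on `Fin m → ℂ`, so the simple ideal is put into
    -- coordinates.
    let e : m ≃ₗ[ℂ] (Fin (Module.finrank ℂ m) → ℂ) := (Module.finBasis ℂ m).equivFun
    let φ : ℂ[G] →ₐ[ℂ] Module.End ℂ (Fin (Module.finrank ℂ m) → ℂ) :=
      (e.conjAlgEquiv ℂ : _ →ₐ[ℂ] _).comp (Algebra.lsmul ℂ ℂ m)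
    let τ : Representation ℂ G (Fin (Module.finrank ℂ m) → ℂ) := (MonoidAlgebra.lift ℂ _ G).symm φ
    have hφ : τ.asAlgebraHom = φ := (MonoidAlgebra.lift ℂ _ G).apply_symm_apply φ
    have hτ : τ.IsIrreducible := by
      rw [Representation.irreducible_iff_isSimpleModule_asModule]
      let l : m ≃ₗ[ℂ[G]] τ.asModule :=
        { (e.trans τ.asModuleEquiv.symm) with
          map_smul' := fun r v => by
            apply τ.asModuleEquiv.injective
            rw [RingHom.id_apply, τ.asModuleEquiv_map_smul, hφ]
            simp [φ] }
      exact IsSimpleModule.congr l.symm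
    obtain ⟨i, ⟨f⟩⟩ := hρ.complete _ τ hτ
    have h1 : τ.asAlgebraHom D (e ⟨x, hx⟩) = 0 := by
      have h2 := (Representation.IntertwiningMap.equivLinearMapAsModule τ (ρ i)
        f.toIntertwiningMap).map_smul D (τ.asModuleEquiv.symm (e ⟨x, hx⟩))
      have h3 : ∀ y : (ρ i).asModule, D • y = 0 := fun y => by
        apply (ρ i).asModuleEquiv.injective
        rw [(ρ i).asModuleEquiv_map_smul, hD, LinearMap.zero_apply, map_zero]
      rw [h3] at h2
      have h4 : D • τ.asModuleEquiv.symm (e ⟨x, hx⟩) = 0 :=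
        f.toLinearEquiv.injective (h2.trans (map_zero f.toLinearEquiv).symm)
      have h5 := congrArg τ.asModuleEquiv h4
      rwa [τ.asModuleEquiv_map_smul, LinearEquiv.apply_symm_apply, map_zero] at h5
    rw [hφ] at h1
    have h6 : e (D • ⟨x, hx⟩) = 0 := by simpa [φ] using h1
    exact congrArg Subtype.val ((LinearEquiv.map_eq_zero_iff e).1 h6)
  have htop := IsSemisimpleModule.sSup_simples_eq_top ℂ[G] ℂ[G]
  have h1 : (1 : ℂ[G]) ∈ sSup {m : Submodule ℂ[G] ℂ[G] | IsSimpleModule ℂ[G] m} := by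
    rw [htop]; trivial
  rw [sSup_eq_iSup'] at h1
  have : D * 1 = 0 := by
    refine Submodule.iSup_induction _ (motive := fun x => D * x = 0) h1 ?_ ?_ ?_
    · rintro ⟨m, hm⟩ x hx
      exact key m hm x hx
    · simp
    · intro x y hx hy
      rw [mul_add, hx, hy, add_zero]
  simpa using this

/-- The expansion of the indicator function of the identity in the irreducible characters. -/
theorem IsIrrepList.sum_dim_mul_blockMatrix [Fintype G] (hρ : IsIrrepList G n ρ) [DecidableEq G]
    (g : G) :
    ∑ a, (n a.1 : ℂ) * blockMatrix ρ g a a = if g = 1 then (Fintype.card G : ℂ) else 0 := by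
  set c : G → ℂ := fun g => ∑ a, (n a.1 : ℂ) * blockMatrix ρ g a a with hc
  -- By orthogonality $\sum_g c(g^{-1})g$ acts on every irreducible as the scalar $|G|$, hence
  -- equals $|G|\cdot 1$; comparing coefficients gives the claim.
  have key : (∑ g, MonoidAlgebra.single g (c g⁻¹) -
      MonoidAlgebra.single 1 (Fintype.card G : ℂ) : ℂ[G]) = 0 := by
    refine hρ.asAlgebraHom_injective _ fun j => ?_
    apply LinearMap.toMatrix'.injective
    ext a b
    simp only [map_sub, map_sum, Representation.asAlgebraHom_single, map_smul, map_one,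
      LinearMap.toMatrix'_one, Matrix.sub_apply, Matrix.sum_apply, Matrix.smul_apply, smul_eq_mul,
      map_zero, Matrix.zero_apply, ← blockMatrix_apply_eq]
    rw [sub_eq_zero]
    simp only [hc, Finset.sum_mul]
    rw [Finset.sum_comm]
    have h1 : ∀ x : Σ i, Fin (n i), ∑ g, (n x.1 : ℂ) * blockMatrix ρ g⁻¹ x x *
        blockMatrix ρ g ⟨j, a⟩ ⟨j, b⟩ = n x.1 * (if (⟨j, a⟩ : Σ i, Fin (n i)) = x ∧
          (⟨j, b⟩ : Σ i, Fin (n i)) = x ∧ j = j then (Fintype.card G : ℂ) / n j else 0) := by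
      intro x
      rw [← hρ.sum_blockMatrix_mul, Finset.mul_sum]
      exact Finset.sum_congr rfl fun g _ => by ring
    have hn : (n j : ℂ) ≠ 0 := Nat.cast_ne_zero.mpr (hρ.dim_pos j).ne'
    simp only [h1, and_true]
    rw [Finset.sum_eq_single ⟨j, a⟩]
    · by_cases hab : a = b
      · subst hab
        simp
        field_simp
      · simp [hab, Ne.symm hab]
    · rintro x - hx
      simp [hx.symm]
    · simp
  have h2 := congrArg (fun D : ℂ[G] => D.coeff g⁻¹) key
  simp [Finsupp.single_apply] at h2
  exact sub_eq_zero.mp h2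

end Irreps

/-! ### Traces of products along the cycles of a permutation -/

section CycleTrace

/-- Expansion over paths from `a` to `b`: `x` lists the interior indices, so `cons a x` gives the
row and `snoc x b` the column of each factor. -/
theorem Matrix.ofFn_prod_apply {J R : Type*} [Fintype J] [DecidableEq J] [CommSemiring R] (m : ℕ)
    (A : Fin (m + 1) → Matrix J J R) (a b : J) :
    (List.ofFn A).prod a b =
      ∑ x : Fin m → J, ∏ k, A k ((Fin.cons a x : Fin (m + 1) → J) k)
        ((Fin.snoc x b : Fin (m + 1) → J) k) := by
  induction m generalizing a with
  | zero => simp [Fin.snoc]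
  | succ m ih =>
    rw [List.ofFn_succ, List.prod_cons, Matrix.mul_apply]
    simp_rw [ih]
    rw [← (Fin.consEquiv fun _ : Fin (m + 1) => J).sum_comp, Fintype.sum_prod_type]
    refine Finset.sum_congr rfl fun c _ => ?_
    rw [Finset.mul_sum]
    refine Finset.sum_congr rfl fun x _ => ?_
    conv_rhs => rw [Fin.prod_univ_succ]
    have h : (Fin.snoc (Fin.cons c x : Fin (m + 1) → J) b : Fin (m + 2) → J) =
        Fin.cons c (Fin.snoc x b : Fin (m + 1) → J) := (Fin.cons_snoc_eq_snoc_cons c x b).symm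
    change _ = A 0 a ((Fin.snoc (Fin.cons c x : Fin (m + 1) → J) b : Fin (m + 2) → J) 0) *
      ∏ k : Fin (m + 1), A k.succ ((Fin.cons c x : Fin (m + 1) → J) k)
        ((Fin.snoc (Fin.cons c x : Fin (m + 1) → J) b : Fin (m + 2) → J) k.succ)
    simp only [h, Fin.cons_zero, Fin.cons_succ]

theorem Matrix.sum_mul_ofFn_prod {J R : Type*} [Fintype J] [DecidableEq J] [CommSemiring R] (m : ℕ)
    (A : Fin (m + 1) → Matrix J J R) (K : J → R) :
    ∑ a, K a * (List.ofFn A).prod a a =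
      ∑ x : Fin (m + 1) → J, K (x 0) * ∏ k, A k (x k) (x (finRotate _ k)) := by
  rw [← (Fin.consEquiv fun _ : Fin (m + 1) => J).sum_comp, Fintype.sum_prod_type]
  refine Finset.sum_congr rfl fun a _ => ?_
  rw [Matrix.ofFn_prod_apply, Finset.mul_sum]
  refine Finset.sum_congr rfl fun x _ => ?_
  simp [Fin.consEquiv, Fin.snoc_eq_cons_rotate]

variable {D : Type*} [Fintype D]

/-- The set of cycles of a permutation, fixed points included. -/
abbrev Equiv.Perm.Orbits (p : Equiv.Perm D) : Type _ := Quotient (Equiv.Perm.SameCycle.setoid p)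

theorem Equiv.Perm.minimalPeriod_pos (p : Equiv.Perm D) (d : D) :
    0 < Function.minimalPeriod p d :=
  Function.minimalPeriod_pos_of_mem_periodicPts (p.injective.mem_periodicPts d)

/-- The points of a cycle of length `m + 1`, counted from a starting point. -/
noncomputable def Equiv.Perm.cycleEquiv (p : Equiv.Perm D) (d : D) (m : ℕ)
    (hm : Function.minimalPeriod p d = m + 1) : Fin (m + 1) ≃ {x // p.SameCycle d x} :=
  Equiv.ofBijective (fun k => ⟨p^[k] d, ⟨(k : ℕ), by
      rw [zpow_natCast, ← Equiv.Perm.iterate_eq_pow]⟩⟩) (by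
    constructor
    · intro k l h
      have h := congrArg Subtype.val h
      exact Fin.ext ((Function.iterate_eq_iterate_iff_of_lt_minimalPeriod
        (k.2.trans_eq hm.symm) (l.2.trans_eq hm.symm)).1 h)
    · rintro ⟨x, hx⟩
      obtain ⟨k, hk⟩ := hx.exists_nat_pow_eq
      refine ⟨⟨k % (m + 1), Nat.mod_lt _ (Nat.succ_pos m)⟩, Subtype.ext ?_⟩
      simp only
      rw [← hm, Function.iterate_mod_minimalPeriod_eq, Equiv.Perm.iterate_eq_pow, hk])

theorem Equiv.Perm.cycleEquiv_finRotate (p : Equiv.Perm D) (d : D) (m : ℕ)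
    (hm : Function.minimalPeriod p d = m + 1) (k : Fin (m + 1)) :
    (p.cycleEquiv d m hm (finRotate _ k) : D) = p (p.cycleEquiv d m hm k) := by
  change p^[(finRotate (m + 1) k : ℕ)] d = p (p^[k] d)
  rw [← Function.iterate_succ_apply' p, ← Function.iterate_mod_minimalPeriod_eq (n := (k : ℕ).succ),
    hm]
  congr 2
  rw [finRotate_apply, Fin.val_add]
  simp

/-- A weighted trace is a sum over closed paths. Indexing the path by the points of the cycle leaves
the starting point visible only in the weight `K`, so different cycles can be merged. -/
theorem sum_mul_map_cycleProd {G J R : Type*} [Group G] [Fintype J] [DecidableEq J]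
    [CommSemiring R] [DecidableEq D] (p : Equiv.Perm D) (ρ : G →* Matrix J J R) (f : D → G)
    (K : J → R) (d : D) [DecidablePred (p.SameCycle d)] :
    ∑ a, K a * ρ (cycleProd p f d) a a =
      ∑ x : {y // p.SameCycle d y} → J, K (x ⟨d, Equiv.Perm.SameCycle.refl p d⟩) *
        ∏ y : {y // p.SameCycle d y}, ρ (f y) (x y) (x ⟨p y, (Equiv.Perm.sameCycle_apply_right).2 y.2⟩) := by
  obtain ⟨m, hm⟩ := Nat.exists_eq_succ_of_ne_zero (p.minimalPeriod_pos d).ne'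
  have h1 : ρ (cycleProd p f d) = (List.ofFn fun k : Fin (m + 1) => ρ (f (p^[k] d))).prod := by
    rw [cycleProd, hm, map_list_prod, List.map_map, List.ofFn_eq_map, ← List.map_coe_finRange_eq_range,
      List.map_map]
    rfl
  rw [h1, Matrix.sum_mul_ofFn_prod]
  refine Fintype.sum_equiv ((p.cycleEquiv d m hm).arrowCongr (Equiv.refl J)) _ _ fun x => ?_
  have h0 : (p.cycleEquiv d m hm).symm ⟨d, Equiv.Perm.SameCycle.refl p d⟩ = 0 := by
    rw [Equiv.symm_apply_eq]; rfl
  congr 1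
  · simp [h0]
  · refine Fintype.prod_equiv (p.cycleEquiv d m hm) _ _ fun k => ?_
    have h2 : (p.cycleEquiv d m hm).symm ⟨p (p.cycleEquiv d m hm k),
        (Equiv.Perm.sameCycle_apply_right).2 (p.cycleEquiv d m hm k).2⟩ = finRotate _ k := by
      rw [Equiv.symm_apply_eq]
      exact Subtype.ext (p.cycleEquiv_finRotate d m hm k).symm
    simp only [Equiv.arrowCongr_apply, Equiv.coe_refl, Function.comp_apply, id_eq, h2,
      Equiv.symm_apply_apply]
    rfl

/-- The cycles partition `D`, so a product of sums over labellings of single cycles is one sum over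
labellings of `D`. -/
theorem prod_orbits_sum_mul_map_cycleProd {G J R : Type*} [Group G] [Fintype J] [DecidableEq J]
    [CommSemiring R] [DecidableEq D] (p : Equiv.Perm D) [Fintype p.Orbits] (ρ : G →* Matrix J J R)
    (f : D → G) (K : J → R) :
    ∏ q : p.Orbits, ∑ a, K a * ρ (cycleProd p f q.out) a a =
      ∑ x : D → J, (∏ q : p.Orbits, K (x q.out)) * ∏ y, ρ (f y) (x y) (x (p y)) := by
  classical
  simp_rw [sum_mul_map_cycleProd p ρ f K]
  rw [Finset.prod_univ_sum, Fintype.piFinset_univ]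
  let e : D ≃ Σ q : p.Orbits, {y // p.SameCycle q.out y} :=
    { toFun := fun y => ⟨Quotient.mk _ y, y, Quotient.exact (s := Equiv.Perm.SameCycle.setoid p) (Quotient.out_eq _)⟩
      invFun := fun y => y.2
      left_inv := fun _ => rfl
      right_inv := by
        rintro ⟨q, y, hy⟩
        have : (Quotient.mk _ y : p.Orbits) = q := by
          rw [← Quotient.out_eq q]; exact (Quotient.sound hy).symm
        subst this
        rfl }
  symm
  refine Fintype.sum_equiv ((e.arrowCongr (Equiv.refl J)).trans (Equiv.piCurry
    fun (q : p.Orbits) (_ : {y // p.SameCycle q.out y}) => J)) _ _ fun x => ?_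
  rw [Finset.prod_mul_distrib]
  congr 1
  rw [← e.symm.prod_comp, Fintype.prod_sigma]
  rfl

end CycleTrace

/-! ### Products along cycles -/

section CycleProd

variable {D G : Type*} [Group G]

/-- The product `f d * f (p d) * ⋯` of the first `k` values along the orbit of `d`. -/
def pathProd (p : Equiv.Perm D) (f : D → G) (d : D) (k : ℕ) : G :=
  ((List.range k).map fun i => f (p^[i] d)).prod

theorem pathProd_zero (p : Equiv.Perm D) (f : D → G) (d : D) : pathProd p f d 0 = 1 := rfl

theorem pathProd_add (p : Equiv.Perm D) (f : D → G) (d : D) (k l : ℕ) :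
    pathProd p f d (k + l) = pathProd p f d k * pathProd p f (p^[k] d) l := by
  simp only [pathProd, List.range_add, List.map_append, List.prod_append, List.map_map]
  congr 2
  refine List.map_congr_left fun i _ => ?_
  simp only [Function.comp_apply]
  rw [add_comm, Function.iterate_add_apply]

theorem pathProd_one (p : Equiv.Perm D) (f : D → G) (d : D) : pathProd p f d 1 = f d := by
  simp [pathProd]

theorem cycleProd_eq_pathProd (p : Equiv.Perm D) (f : D → G) (d : D) :
    cycleProd p f d = pathProd p f d (Function.minimalPeriod p d) := rfl

/-- Shifting the starting point conjugates the product. -/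
theorem cycleProd_apply_eq_one_iff [Finite D] (p : Equiv.Perm D) (f : D → G) (d : D) :
    cycleProd p f (p d) = 1 ↔ cycleProd p f d = 1 := by
  have h : f d * cycleProd p f (p d) = cycleProd p f d * f d := by
    have h1 := pathProd_add p f d 1 (Function.minimalPeriod p d)
    have h2 := pathProd_add p f d (Function.minimalPeriod p d) 1
    rw [add_comm, h2, Function.iterate_minimalPeriod, pathProd_one, Function.iterate_one] at h1
    rw [cycleProd_eq_pathProd, cycleProd_eq_pathProd, h1]
    rw [Function.minimalPeriod_apply (p.injective.mem_periodicPts d)]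
  rw [← mul_right_inj (f d), h]
  simp

theorem cycleProd_eq_one_iff_of_sameCycle [Finite D] (p : Equiv.Perm D) (f : D → G) {d d' : D}
    (h : p.SameCycle d d') : cycleProd p f d = 1 ↔ cycleProd p f d' = 1 := by
  obtain ⟨k, rfl⟩ := h.exists_nat_pow_eq
  clear h
  induction k with
  | zero => rfl
  | succ k ih => rw [ih, pow_succ', Equiv.Perm.mul_apply, cycleProd_apply_eq_one_iff]

theorem pathProd_mul_minimalPeriod (p : Equiv.Perm D) (f : D → G) (d : D) (k : ℕ) :
    pathProd p f d (Function.minimalPeriod p d * k) = cycleProd p f d ^ k := by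
  induction k with
  | zero => simp [pathProd_zero]
  | succ k ih =>
    rw [Nat.mul_succ, pathProd_add, ih, pow_succ, cycleProd_eq_pathProd]
    congr 2
    exact (Function.isPeriodicPt_minimalPeriod p d).mul_const k

end CycleProd

/-! ### Sums and counts of labellings -/

section InvariantFunctions

variable {D J R : Type*}

theorem Fintype.prod_ite_zero' {ι : Type*} [Fintype ι] [CommMonoidWithZero R] (P : ι → Prop)
    [DecidablePred P] [Decidable (∀ i, P i)] (a : ι → R) :
    ∏ i, (if P i then a i else 0) = if ∀ i, P i then ∏ i, a i else 0 := by
  rw [Finset.prod_ite_zero]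
  simp

theorem sum_ite_invariant [Fintype D] [DecidableEq D] [Fintype J] [AddCommMonoid R]
    (p : Equiv.Perm D) [Fintype (p.Orbits → J)] [DecidablePred fun x : D → J => ∀ d, x (p d) = x d]
    (H : (D → J) → R) :
    ∑ x : D → J, (if ∀ d, x (p d) = x d then H x else 0) =
      ∑ j : p.Orbits → J, H fun d => j (Quotient.mk _ d) := by
  rw [← Finset.sum_filter]
  symm
  refine Finset.sum_bij (fun j _ d => j (Quotient.mk _ d)) ?_ ?_ ?_ ?_
  · intro j _
    simp only [Finset.mem_filter, Finset.mem_univ, true_and]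
    intro d
    congr 1
    exact Quotient.sound ((Equiv.Perm.sameCycle_apply_left).2 (Equiv.Perm.SameCycle.refl p d))
  · intro j _ j' _ h
    ext q
    induction q using Quotient.inductionOn with
    | _ d => exact congrFun h d
  · intro x hx
    simp only [Finset.mem_filter, Finset.mem_univ, true_and] at hx
    refine ⟨Quotient.lift x ?_, Finset.mem_univ _, rfl⟩
    intro a b hab
    obtain ⟨k, rfl⟩ := Equiv.Perm.SameCycle.exists_nat_pow_eq hab
    clear hab
    induction k with
    | zero => rfl
    | succ k ih => rw [pow_succ', Equiv.Perm.mul_apply, hx]; exact ih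
  · intro j _
    rfl

theorem prod_comp_eq_prod_pow_card {α β : Type*} [Fintype α] [Fintype β] [CommMonoid R]
    (g : α → β) (f : β → R) : ∏ x, f (g x) = ∏ b, f b ^ Nat.card {x // g x = b} := by
  classical
  rw [← Fintype.prod_fiberwise' g f]
  simp

theorem card_filter_fst_eq {F ι : Type*} [Fintype F] (n : ι → ℕ) (b : F → ι)
    [Fintype (F → Σ i, Fin (n i))]
    [DecidablePred fun j : F → Σ i, Fin (n i) => ∀ x, (j x).1 = b x] :
    ({j : F → Σ i, Fin (n i) | ∀ x, (j x).1 = b x} : Finset _).card = ∏ x, n (b x) := by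
  classical
  have : ({j : F → Σ i, Fin (n i) | ∀ x, (j x).1 = b x} : Finset _) =
      Fintype.piFinset fun x => (Finset.univ : Finset (Fin (n (b x)))).map
        (Function.Embedding.sigmaMk (b x)) := by
    ext j
    simp only [Finset.mem_filter, Finset.mem_univ, true_and, Fintype.mem_piFinset, Finset.mem_map,
      Function.Embedding.sigmaMk_apply]
    refine forall_congr' fun x => ⟨fun h => ?_, fun ⟨a, h⟩ => by rw [← h]⟩
    rw [← h]
    exact ⟨(j x).2, rfl⟩
  rw [this, Fintype.card_piFinset]
  simp

end InvariantFunctions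

/-! ### The number of local flows -/

@[simp]
theorem dartFlip_dartFlip (E : Type*) (d : E × Bool) : dartFlip E (dartFlip E d) = d := by
  simp [dartFlip, Prod.map]

namespace SurfaceMap

variable {V E : Type*} (M : SurfaceMap V E)

theorem vert_rot (d : E × Bool) : M.vert (M.rot d) = M.vert d :=
  (M.vert_eq_iff _ _).2 ((Equiv.Perm.sameCycle_apply_left).2 (Equiv.Perm.SameCycle.refl _ d))

theorem comp_surjective : Function.Surjective M.comp := Quot.mk_surjective

theorem faceComp_surjective : Function.Surjective M.faceComp := by
  intro C
  obtain ⟨v, rfl⟩ := M.comp_surjective C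
  by_cases h : ∃ d, M.vert d = v
  · obtain ⟨d, rfl⟩ := h
    exact ⟨Sum.inl (Quotient.mk _ d), rfl⟩
  · push Not at h
    exact ⟨Sum.inr ⟨v, h⟩, rfl⟩

/-- Every vertex is either a cycle of the rotation system or isolated. -/
noncomputable def vertexEquiv :
    M.rot.Orbits ⊕ {v : V // ∀ d, M.vert d ≠ v} ≃ V :=
  Equiv.ofBijective
    (Sum.elim (Quotient.lift M.vert fun d d' h => (M.vert_eq_iff d d').2 h) Subtype.val) (by
      constructor
      · rintro (q | v) (q' | v') h
        · induction q using Quotient.inductionOn with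
          | _ d =>
          induction q' using Quotient.inductionOn with
          | _ d' => exact congrArg Sum.inl (Quotient.sound ((M.vert_eq_iff d d').1 h))
        · induction q using Quotient.inductionOn with
          | _ d => exact absurd h (v'.2 d)
        · induction q' using Quotient.inductionOn with
          | _ d => exact absurd h.symm (v.2 d)
        · exact congrArg Sum.inr (Subtype.ext h)
      · intro v
        by_cases h : ∃ d, M.vert d = v
        · obtain ⟨d, rfl⟩ := h
          exact ⟨Sum.inl (Quotient.mk _ d), rfl⟩
        · push Not at h
          exact ⟨Sum.inr ⟨v, h⟩, rfl⟩)

variable {G : Type*} [Group G]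

/-- Faces meeting at a corner, that is, faces of rotation-consecutive darts, already generate the
relation "same component". Equality at corners makes `t` constant around vertices and across edges,
so it descends to vertices and then to components. -/
theorem exists_component_function_iff {ι : Type*} (t : M.Face → ι) :
    (∃ c : M.Component → ι, ∀ F, t F = c (M.faceComp F)) ↔
      ∀ d, t (Sum.inl (Quotient.mk _ d)) = t (Sum.inl (Quotient.mk _ (M.rot⁻¹ d))) := by
  classical
  constructor
  · rintro ⟨c, hc⟩ d
    rw [hc, hc]
    congr 1
    change M.comp (M.vert d) = M.comp (M.vert (M.rot⁻¹ d))
    rw [← M.vert_rot (M.rot⁻¹ d), Equiv.Perm.coe_inv, Equiv.apply_symm_apply]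
  · intro h
    have hrot : ∀ d d', M.rot.SameCycle d d' →
        t (Sum.inl (Quotient.mk _ d)) = t (Sum.inl (Quotient.mk _ d')) := by
      rintro d _ ⟨k, rfl⟩
      induction k using Int.induction_on with
      | zero => rfl
      | succ k ih =>
        rw [ih, h ((M.rot ^ ((k : ℤ) + 1)) d), ← Equiv.Perm.mul_apply, ← zpow_neg_one, ← zpow_add,
          neg_add_cancel_comm_assoc]
      | pred k ih =>
        rw [ih, h, ← Equiv.Perm.mul_apply, ← zpow_neg_one, ← zpow_add]
        congr 5
        ring
    -- The dart preceding `dartFlip E d` is `M.faceRot d`, which lies on the face of `d`.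
    have hflip : ∀ d, t (Sum.inl (Quotient.mk _ (dartFlip E d))) = t (Sum.inl (Quotient.mk _ d)) := by
      intro d
      rw [h (dartFlip E d)]
      congr 2
      exact Quotient.sound ((Equiv.Perm.sameCycle_apply_left (f := M.faceRot)).2
        (Equiv.Perm.SameCycle.refl _ d))
    let s : V → ι := fun v => if hv : ∃ d, M.vert d = v then
      t (Sum.inl (Quotient.mk _ hv.choose)) else t (Sum.inr ⟨v, fun d hd => hv ⟨d, hd⟩⟩)
    have hs : ∀ d, s (M.vert d) = t (Sum.inl (Quotient.mk _ d)) := by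
      intro d
      have hv : ∃ d', M.vert d' = M.vert d := ⟨d, rfl⟩
      simp only [s, dif_pos hv]
      exact hrot _ _ ((M.vert_eq_iff _ _).1 hv.choose_spec)
    refine ⟨Quot.lift s ?_, ?_⟩
    · rintro _ _ ⟨e, rfl, rfl⟩
      rw [hs, hs]
      exact hflip (e, false)
    · rintro (q | v)
      · induction q using Quotient.inductionOn with
        | _ d => exact (hs d).symm
      · have hv : ¬ ∃ d, M.vert d = v := fun ⟨d, hd⟩ => v.2 d hd
        change _ = s v
        simp only [s, dif_neg hv]

theorem isLocalFlow_iff_forall_orbits [Finite E] (o : E → Bool) (w : E → G) :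
    M.IsLocalFlow o w ↔ ∀ q : M.rot.Orbits, cycleProd M.rot (dartValue o w) q.out = 1 := by
  refine ⟨fun h q => h _, fun h d => ?_⟩
  refine (cycleProd_eq_one_iff_of_sameCycle M.rot _ ?_).1 (h (Quotient.mk _ d))
  exact Quotient.exact (s := Equiv.Perm.SameCycle.setoid M.rot) (Quotient.out_eq _)

variable [Fintype E] {ℓ : ℕ} {n : Fin ℓ → ℕ} {ρ : ∀ i, Representation ℂ G (Fin (n i) → ℂ)}

open Classical in
-- Each vertex condition is replaced by its character expansion, at the cost of a factor $|G|$ per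
-- non-isolated vertex. The weight is read at one chosen dart of the vertex.
theorem card_pow_mul_card_isLocalFlow_eq_sum [Fintype G] (hρ : IsIrrepList G n ρ) (o : E → Bool) :
    (Fintype.card G : ℂ) ^ Fintype.card M.rot.Orbits * Nat.card {w : E → G // M.IsLocalFlow o w} =
      ∑ x : E × Bool → Σ i, Fin (n i), (∏ q : M.rot.Orbits, (n (x q.out).1 : ℂ)) *
        ∑ w : E → G, ∏ d, blockMatrix ρ (dartValue o w d) (x d) (x (M.rot d)) := by
  simp_rw [Finset.mul_sum]
  rw [Finset.sum_comm]
  simp_rw [← prod_orbits_sum_mul_map_cycleProd M.rot (blockMatrix ρ) _ (fun a => (n a.1 : ℂ)),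
    hρ.sum_dim_mul_blockMatrix]
  rw [Nat.card_eq_fintype_card, Fintype.card_subtype, Finset.card_filter]
  push_cast
  rw [Finset.mul_sum]
  refine Finset.sum_congr rfl fun w _ => ?_
  rw [Finset.prod_ite_zero]
  simp [M.isLocalFlow_iff_forall_orbits]

open Classical in
-- The two darts of `e` contribute coefficients of `w e` and of its inverse, so the sum over `w` is
-- a product over edges of orthogonality sums.
theorem sum_prod_blockMatrix_dartValue [Fintype G] (hρ : IsIrrepList G n ρ) (o : E → Bool)
    (x : E × Bool → Σ i, Fin (n i)) :
    ∑ w : E → G, ∏ d, blockMatrix ρ (dartValue o w d) (x d) (x (M.rot d)) =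
      if (∀ d, x (M.rot (dartFlip E d)) = x d) ∧ ∀ d, (x (M.rot d)).1 = (x d).1 then
        ∏ e, (Fintype.card G : ℂ) / n (x (e, o e)).1 else 0 := by
  have h1 : ∀ w : E → G, ∏ d, blockMatrix ρ (dartValue o w d) (x d) (x (M.rot d)) =
      ∏ e, blockMatrix ρ (w e) (x (e, o e)) (x (M.rot (e, o e))) *
        blockMatrix ρ (w e)⁻¹ (x (e, !o e)) (x (M.rot (e, !o e))) := by
    intro w
    rw [Fintype.prod_prod_type]
    refine Finset.prod_congr rfl fun e _ => ?_
    cases h : o e <;> simp [dartValue, h, mul_comm]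
  simp_rw [h1]
  rw [← Fintype.piFinset_univ, ← Finset.prod_univ_sum (fun _ : E => (Finset.univ : Finset G))
    (fun e g => blockMatrix ρ g (x (e, o e)) (x (M.rot (e, o e))) *
        blockMatrix ρ g⁻¹ (x (e, !o e)) (x (M.rot (e, !o e))))]
  simp_rw [hρ.sum_blockMatrix_mul]
  rw [Fintype.prod_ite_zero']
  refine if_congr ?_ rfl rfl
  constructor
  · intro h
    constructor
    · rintro ⟨e, b⟩
      obtain ⟨h1, h2, h3⟩ := h e
      rcases Bool.eq_or_eq_not b (o e) with rfl | rfl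
      · exact h1.symm
      · simpa [dartFlip] using h2
    · rintro ⟨e, b⟩
      obtain ⟨h1, h2, h3⟩ := h e
      rcases Bool.eq_or_eq_not b (o e) with rfl | rfl
      · exact h3.symm
      · rw [← h1, ← h2, h3]
  · rintro ⟨h1, h2⟩ e
    exact ⟨(h1 (e, o e)).symm, by simpa [dartFlip] using h1 (e, !o e), (h2 _).symm⟩

open Classical in
theorem card_pow_mul_card_isLocalFlow_eq_sum_faces [Fintype G] [Fintype V] [Fintype M.Face]
    (hρ : IsIrrepList G n ρ) (o : E → Bool) :
    (Fintype.card G : ℂ) ^ Fintype.card V * Nat.card {w : E → G // M.IsLocalFlow o w} =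
      ∑ j : M.Face → Σ i, Fin (n i),
        if ∃ c : M.Component → Fin ℓ, ∀ F, (j F).1 = c (M.faceComp F) then
        (∏ q : M.rot.Orbits, (n (j (Sum.inl (Quotient.mk _ (M.rot⁻¹ q.out)))).1 : ℂ)) *
        (∏ v : {v : V // ∀ d, M.vert d ≠ v}, (n (j (Sum.inr v)).1 : ℂ)) *
        ∏ e, (Fintype.card G : ℂ) / n (j (Sum.inl (Quotient.mk _ (M.rot⁻¹ (e, o e))))).1 else 0 := by
  rw [← Fintype.card_congr M.vertexEquiv, Fintype.card_sum, pow_add, mul_right_comm,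
    M.card_pow_mul_card_isLocalFlow_eq_sum hρ]
  simp_rw [M.sum_prod_blockMatrix_dartValue hρ]
  have hcard : ∑ a : Σ i, Fin (n i), (n a.1 : ℂ) = Fintype.card G := by
    simpa using hρ.sum_dim_mul_blockMatrix 1
  -- An isolated vertex imposes no condition; writing its factor as $|G|=\sum_a n_a$ supplies a
  -- label for its single face.
  have hiso : (Fintype.card G : ℂ) ^ Fintype.card {v : V // ∀ d, M.vert d ≠ v} =
      ∑ y : {v : V // ∀ d, M.vert d ≠ v} → Σ i, Fin (n i), ∏ v, (n (y v).1 : ℂ) := by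
    rw [← Fintype.piFinset_univ, ← Finset.prod_univ_sum
      (fun _ => (Finset.univ : Finset (Σ i, Fin (n i)))) (fun _ a => (n a.1 : ℂ)), hcard]
    simp
  -- Substituting `x = z ∘ M.rot⁻¹` turns the edge conditions into invariance of `z` under
  -- `faceRot`, so `z` is a labelling of faces.
  rw [hiso, ← (M.rot.arrowCongr (Equiv.refl (Σ i, Fin (n i)))).sum_comp]
  have h1 : ∀ z : E × Bool → Σ i, Fin (n i),
      (∀ d, z (M.rot⁻¹ (M.rot (dartFlip E d))) = z (M.rot⁻¹ d)) ↔ ∀ d, z (M.faceRot d) = z d := by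
    intro z
    constructor
    · intro h d
      simpa [faceRot] using (h (dartFlip E d)).symm
    · intro h d
      simpa [faceRot] using (h (dartFlip E d)).symm
  simp only [Equiv.arrowCongr_apply, Equiv.coe_refl, Function.comp_apply, id_eq,
    ← Equiv.Perm.inv_def, h1, ite_and]
  simp only [mul_ite, mul_zero]
  rw [sum_ite_invariant M.faceRot, Finset.sum_mul_sum, ← Fintype.sum_prod_type',
    ← (Equiv.sumArrowEquivProdArrow _ _ _).sum_comp]
  refine Finset.sum_congr rfl fun j _ => ?_
  simp only [M.exists_component_function_iff (fun F => (j F).1)]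
  have h2 : ∀ d, M.rot⁻¹ (M.rot d) = d := M.rot.symm_apply_apply
  simp only [h2, ite_mul, zero_mul]
  exact if_congr Iff.rfl (mul_right_comm _ _ _) rfl

theorem card_isLocalFlow_eq_prod [Finite G] [Finite V] (hρ : IsIrrepList G n ρ) (o : E → Bool) :
    (Nat.card {w : E → G // M.IsLocalFlow o w} : ℚ) =
      (Nat.card G : ℚ) ^ ((M.numEdges : ℤ) - M.numVertices) *
        ∏ C : M.Component, ∑ i, (n i : ℚ) ^ (M.eulerChar C) := by
  classical
  have := Fintype.ofFinite G
  have := Fintype.ofFinite V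
  have := Fintype.ofFinite M.Face
  have hn : ∀ i, (n i : ℂ) ≠ 0 := fun i => Nat.cast_ne_zero.mpr (hρ.dim_pos i).ne'
  have hG : (Fintype.card G : ℂ) ≠ 0 := Nat.cast_ne_zero.mpr Fintype.card_ne_zero
  have hvert : ∀ d, M.vert (M.rot⁻¹ d) = M.vert d := fun d => by
    rw [← M.vert_rot (M.rot⁻¹ d), Equiv.Perm.coe_inv, Equiv.apply_symm_apply]
  have hedge : ∀ e b, M.comp (M.vert (e, b)) = M.comp (M.vert (e, true)) := by
    rintro e (_ | _)
    · exact M.comp_vert_dartFlip (e, true)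
    · rfl
  have h1 := M.card_pow_mul_card_isLocalFlow_eq_sum_faces hρ o
  -- Every component contains a face, so the `c` in the existential is unique and the condition may
  -- be written as a sum over `c`.
  have h2 : ∀ j : M.Face → Σ i, Fin (n i),
      (if ∃ c : M.Component → Fin ℓ, ∀ F, (j F).1 = c (M.faceComp F) then
        (∏ q : M.rot.Orbits, (n (j (Sum.inl (Quotient.mk _ (M.rot⁻¹ q.out)))).1 : ℂ)) *
        (∏ v : {v : V // ∀ d, M.vert d ≠ v}, (n (j (Sum.inr v)).1 : ℂ)) *
        ∏ e, (Fintype.card G : ℂ) / n (j (Sum.inl (Quotient.mk _ (M.rot⁻¹ (e, o e))))).1 else 0) =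
      ∑ c : M.Component → Fin ℓ, if ∀ F, (j F).1 = c (M.faceComp F) then
        (∏ v, (n (c (M.comp v)) : ℂ)) *
          ∏ e, (Fintype.card G : ℂ) / n (c (M.comp (M.vert (e, true)))) else 0 := by
    intro j
    split_ifs with h
    · obtain ⟨c, hc⟩ := h
      rw [Finset.sum_eq_single c, if_pos hc]
      · rw [← M.vertexEquiv.prod_comp, Fintype.prod_sum_type]
        simp only [hc]
        congr 1
        · congr 1
          refine Finset.prod_congr rfl fun q _ => ?_
          conv_rhs => rw [← Quotient.out_eq q]
          change (n (c (M.comp (M.vert (M.rot⁻¹ q.out)))) : ℂ) = n (c (M.comp (M.vert q.out)))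
          rw [hvert]
        · refine Finset.prod_congr rfl fun e _ => ?_
          change (_ : ℂ) / (n (c (M.comp (M.vert (M.rot⁻¹ (e, o e))))) : ℂ) = _
          rw [hvert, hedge]
      · intro c' _ hc'
        refine if_neg fun h => hc' ?_
        ext C
        obtain ⟨F, rfl⟩ := M.faceComp_surjective C
        rw [← h, ← hc]
      · simp
    · refine (Finset.sum_eq_zero fun c _ => if_neg fun hc => h ⟨c, hc⟩).symm
  simp_rw [h2] at h1
  rw [Finset.sum_comm] at h1
  have h3 : ∀ c : M.Component → Fin ℓ, (∑ j : M.Face → Σ i, Fin (n i),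
      if ∀ F, (j F).1 = c (M.faceComp F) then
        (∏ v, (n (c (M.comp v)) : ℂ)) *
          ∏ e, (Fintype.card G : ℂ) / n (c (M.comp (M.vert (e, true)))) else 0) =
      (Fintype.card G : ℂ) ^ Fintype.card E * ∏ C, (n (c C) : ℂ) ^ M.eulerChar C := by
    intro c
    rw [← Finset.sum_filter, Finset.sum_const, card_filter_fst_eq, nsmul_eq_mul,
      Finset.prod_div_distrib, Finset.prod_const, Finset.card_univ, Nat.cast_prod,
      prod_comp_eq_prod_pow_card M.faceComp (fun C => (n (c C) : ℂ)),
      prod_comp_eq_prod_pow_card M.comp (fun C => (n (c C) : ℂ)),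
      prod_comp_eq_prod_pow_card (fun e => M.comp (M.vert (e, true))) (fun C => (n (c C) : ℂ))]
    simp only [eulerChar, zpow_add₀ (hn _), zpow_sub₀ (hn _), Finset.prod_mul_distrib,
      Finset.prod_div_distrib, zpow_natCast]
    ring
  simp_rw [h3, ← Finset.mul_sum] at h1
  have h4 := Finset.prod_univ_sum (fun _ : M.Component => (Finset.univ : Finset (Fin ℓ)))
    (fun C i => (n i : ℂ) ^ M.eulerChar C)
  rw [Fintype.piFinset_univ] at h4
  rw [← h4] at h1
  have h5 : (Nat.card {w : E → G // M.IsLocalFlow o w} : ℂ) =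
      (Nat.card G : ℂ) ^ ((M.numEdges : ℤ) - M.numVertices) *
        ∏ C : M.Component, ∑ i, (n i : ℂ) ^ (M.eulerChar C) := by
    rw [zpow_sub₀ (by rwa [Nat.card_eq_fintype_card]), numEdges, numVertices, zpow_natCast,
      zpow_natCast, div_mul_eq_mul_div, eq_div_iff (by simp [hG])]
    simp only [Nat.card_eq_fintype_card] at h1 ⊢
    rw [← h1, mul_comm]
  apply Rat.cast_injective (α := ℂ)
  push_cast
  exact h5

end SurfaceMap

/-! ### Local flows and deletion -/

section CycleProdTransfer

variable {α β G : Type*} [Group G]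

/-- A closed path of `p` runs some number of times around the cycle, so its product is a power of
the cycle product. This avoids comparing minimal periods of `p` and `q`. -/
theorem cycleProd_eq_one_of_pathProd {p : Equiv.Perm α} {q : Equiv.Perm β} {f : α → G} {g : β → G}
    {x : α} {y : β}
    (h : ∃ k, p^[k] x = x ∧ pathProd p f x k = pathProd q g y (Function.minimalPeriod q y))
    (hp : cycleProd p f x = 1) : cycleProd q g y = 1 := by
  obtain ⟨k, hk, hprod⟩ := h
  obtain ⟨m, rfl⟩ := Function.IsPeriodicPt.minimalPeriod_dvd hk
  rw [cycleProd_eq_pathProd, ← hprod, pathProd_mul_minimalPeriod, hp, one_pow]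

theorem permCongr_iterate (e : α ≃ β) (p : Equiv.Perm α) (x : α) (k : ℕ) :
    (e.permCongr p)^[k] (e x) = e (p^[k] x) := by
  induction k with
  | zero => rfl
  | succ k ih => rw [Function.iterate_succ_apply', Function.iterate_succ_apply', ih]; simp

theorem pathProd_permCongr (e : α ≃ β) (p : Equiv.Perm α) (f : β → G) (x : α) (k : ℕ) :
    pathProd (e.permCongr p) f (e x) k = pathProd p (f ∘ e) x k := by
  simp [pathProd, permCongr_iterate]

theorem cycleProd_permCongr_eq_one_iff (e : α ≃ β) (p : Equiv.Perm α) (f : β → G) (x : α) :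
    cycleProd (e.permCongr p) f (e x) = 1 ↔ cycleProd p (f ∘ e) x = 1 := by
  refine ⟨cycleProd_eq_one_of_pathProd ⟨_, ?_, pathProd_permCongr e p f x _⟩,
    cycleProd_eq_one_of_pathProd ⟨_, ?_, (pathProd_permCongr e p f x _).symm⟩⟩
  · rw [permCongr_iterate, Function.iterate_minimalPeriod]
  · apply e.injective
    rw [← permCongr_iterate, Function.iterate_minimalPeriod]

variable [Finite α] (p : Equiv.Perm α) (S : Set α) {f : α → G}

theorem pathProd_returnTime (hf : ∀ x, x ∉ S → f x = 1) (x : S) :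
    pathProd p f x (returnTime p S x) = f x := by
  have h : ∀ k, 0 < k → k ≤ returnTime p S x → pathProd p f x k = f x := by
    intro k hk
    induction k, hk using Nat.le_induction with
    | base => intro _; exact pathProd_one p f x
    | succ k hk ih =>
      intro hle
      rw [pathProd_add, ih (by omega), pathProd_one, mul_eq_left]
      refine hf _ ?_
      intro hmem
      have := returnTime_le p S x hk hmem
      omega
  exact h _ (returnTime_pos p S x) le_rfl

/-- Skipped points carry the value `1`, so each step of the first-return map has the same product as
the stretch of the `p`-orbit that it replaces. -/
theorem exists_pathProd_eq_pathProd_firstReturn (hf : ∀ x, x ∉ S → f x = 1) (x : S) (k : ℕ) :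
    ∃ m, p^[m] x.1 = (firstReturn p S)^[k] x ∧
      pathProd p f x m = pathProd (firstReturn p S) (fun y => f y) x k := by
  induction k generalizing x with
  | zero => exact ⟨0, rfl, rfl⟩
  | succ k ih =>
    obtain ⟨m, hm, hprod⟩ := ih (firstReturn p S x)
    refine ⟨returnTime p S x + m, ?_, ?_⟩
    · rw [add_comm, Function.iterate_add_apply, Function.iterate_succ_apply, ← hm,
        firstReturn_apply]
    · rw [pathProd_add, pathProd_returnTime p S hf, ← firstReturn_apply, hprod, add_comm,
        pathProd_add, pathProd_one, Function.iterate_one]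

theorem exists_pathProd_firstReturn_eq_pathProd (hf : ∀ x, x ∉ S → f x = 1) (x : S) (m : ℕ)
    (hm : p^[m] x.1 ∈ S) :
    ∃ k, ((firstReturn p S)^[k] x).1 = p^[m] x.1 ∧
      pathProd (firstReturn p S) (fun y => f y) x k = pathProd p f x m := by
  induction m using Nat.strong_induction_on generalizing x with
  | _ m ih =>
    rcases Nat.eq_zero_or_pos m with rfl | h0
    · exact ⟨0, rfl, rfl⟩
    · have hpos := returnTime_pos p S x
      obtain ⟨l, rfl⟩ := Nat.exists_eq_add_of_le (returnTime_le p S x h0 hm)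
      have hit : p^[returnTime p S x + l] x.1 = p^[l] (firstReturn p S x).1 := by
        rw [add_comm, Function.iterate_add_apply, firstReturn_apply]
      rw [hit] at hm ⊢
      obtain ⟨k, hk, hprod⟩ := ih l (by omega) (firstReturn p S x) hm
      refine ⟨1 + k, ?_, ?_⟩
      · rw [add_comm, Function.iterate_add_apply, Function.iterate_one, hk]
      · rw [pathProd_add, pathProd_add, pathProd_one, Function.iterate_one, hprod,
          pathProd_returnTime p S hf, firstReturn_apply]

theorem cycleProd_firstReturn_eq_one_iff (hf : ∀ x, x ∉ S → f x = 1) (x : S) :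
    cycleProd (firstReturn p S) (fun y => f y) x = 1 ↔ cycleProd p f x = 1 := by
  constructor
  · refine cycleProd_eq_one_of_pathProd ?_
    obtain ⟨k, hk, h⟩ := exists_pathProd_firstReturn_eq_pathProd p S hf x
      (Function.minimalPeriod p x) (by rw [Function.iterate_minimalPeriod]; exact x.2)
    rw [Function.iterate_minimalPeriod] at hk
    exact ⟨k, Subtype.ext hk, h⟩
  · refine cycleProd_eq_one_of_pathProd ?_
    obtain ⟨m, hm, h⟩ := exists_pathProd_eq_pathProd_firstReturn p S hf x
      (Function.minimalPeriod (firstReturn p S) x)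
    rw [Function.iterate_minimalPeriod] at hm
    exact ⟨m, hm, h⟩

end CycleProdTransfer

namespace SurfaceMap

variable {V E G : Type*} [Group G] (M : SurfaceMap V E)

theorem isLocalFlow_delete_iff [Finite E] (B : Set E) (o : E → Bool) (w : E → G)
    (hw : ∀ e ∈ B, w e = 1) :
    (M.delete B).IsLocalFlow (fun e => o e) (fun e => w e) ↔ M.IsLocalFlow o w := by
  have hf : ∀ d : E × Bool, d ∉ {d : E × Bool | d.1 ∉ B} → dartValue o w d = 1 := by
    intro d hd
    have : w d.1 = 1 := hw _ (by simpa using hd)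
    simp [dartValue, this]
  have key : ∀ x : {d : E × Bool | d.1 ∉ B},
      cycleProd (M.delete B).rot (dartValue (fun e : {e // e ∉ B} => o e) (fun e => w e))
        (Equiv.prodSubtypeFstEquivSubtypeProd (p := fun e : E => e ∉ B) x) = 1 ↔
      cycleProd M.rot (dartValue o w) x = 1 := by
    intro x
    refine Iff.trans ?_ (cycleProd_firstReturn_eq_one_iff M.rot {d : E × Bool | d.1 ∉ B} hf x)
    exact cycleProd_permCongr_eq_one_iff (Equiv.prodSubtypeFstEquivSubtypeProd
      (p := fun e : E => e ∉ B)) (firstReturn M.rot {d : E × Bool | d.1 ∉ B}) _ x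
  constructor
  · intro h d
    by_cases hd : ∃ x : {d : E × Bool | d.1 ∉ B}, M.rot.SameCycle x d
    · obtain ⟨x, hx⟩ := hd
      exact (cycleProd_eq_one_iff_of_sameCycle M.rot _ hx).1 ((key x).1 (h _))
    -- A vertex all of whose darts are deleted has no cycle in `M.delete B`, but its values are all
    -- `1`.
    · refine List.prod_eq_one fun y hy => ?_
      obtain ⟨i, -, rfl⟩ := List.mem_map.1 hy
      refine hf _ fun hi => hd ⟨⟨_, hi⟩, ?_⟩
      change M.rot.SameCycle (M.rot^[i] d) d
      rw [Equiv.Perm.iterate_eq_pow]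
      exact (Equiv.Perm.sameCycle_pow_left).2 (Equiv.Perm.SameCycle.refl _ _)
  · intro h d
    obtain ⟨x, rfl⟩ := (Equiv.prodSubtypeFstEquivSubtypeProd (p := fun e : E => e ∉ B)).surjective d
    exact (key x).2 (h x)

theorem card_isLocalFlow_delete [Finite E] (B : Set E) (o : E → Bool) :
    Nat.card {w : {e // e ∉ B} → G // (M.delete B).IsLocalFlow (fun e => o e) w} =
      Nat.card {w : E → G // M.IsLocalFlow o w ∧ ∀ e ∈ B, w e = 1} := by
  classical
  refine (Nat.card_congr (Equiv.ofBijective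
    (fun w => ⟨fun e => w.1 e, (M.isLocalFlow_delete_iff B o w.1 w.2.2).2 w.2.1⟩) ⟨?_, ?_⟩)).symm
  · intro w w' h
    apply Subtype.ext
    ext e
    by_cases he : e ∈ B
    · rw [w.2.2 e he, w'.2.2 e he]
    · exact congrFun (congrArg Subtype.val h) ⟨e, he⟩
  · rintro ⟨w, hw⟩
    have h1 : ∀ e ∈ B, (fun e => if h : e ∉ B then w ⟨e, h⟩ else 1) e = 1 := fun e he => by
      simp [he]
    have h2 : (fun e : {e // e ∉ B} => (fun e => if h : e ∉ B then w ⟨e, h⟩ else 1) e.1) = w := by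
      ext e
      simp [e.2]
    refine ⟨⟨fun e => if h : e ∉ B then w ⟨e, h⟩ else 1, ?_, h1⟩, Subtype.ext h2⟩
    rw [← M.isLocalFlow_delete_iff B o _ h1]
    rwa [h2]

/-- Nowhere-identity local flows, by inclusion and exclusion. -/
theorem numNowhereIdentityFlows_eq_sum [Fintype E] [Finite G] (o : E → Bool) :
    (M.numNowhereIdentityFlows o G : ℚ) = ∑ B : Finset E, (-1) ^ B.card *
      (Nat.card {w : {e // e ∉ (B : Set E)} → G //
        (M.delete (B : Set E)).IsLocalFlow (fun e => o e) w} : ℚ) := by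
  classical
  have := Fintype.ofFinite G
  simp_rw [card_isLocalFlow_delete, numNowhereIdentityFlows, Nat.card_eq_fintype_card,
    Fintype.card_subtype, Finset.card_filter]
  push_cast
  simp_rw [Finset.mul_sum]
  rw [Finset.sum_comm]
  refine Finset.sum_congr rfl fun w _ => ?_
  by_cases hw : M.IsLocalFlow o w
  swap
  · simp [hw]
  -- Inclusion and exclusion: expanding $\prod_e(1-[w_e=1])$ gives the signed sum over `B`.
  have h1 : ∏ e, ((1 : ℚ) + if w e = 1 then -1 else 0) = if ∀ e, w e ≠ 1 then 1 else 0 := by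
    rw [← Finset.prod_const_one (ι := E) (s := Finset.univ), ← Fintype.prod_ite_zero']
    refine Finset.prod_congr rfl fun e _ => ?_
    by_cases h : w e = 1 <;> simp [h]
  simp only [hw, true_and]
  rw [← h1, Finset.prod_one_add, Finset.powerset_univ]
  refine Finset.sum_congr rfl fun B _ => ?_
  rw [Finset.prod_ite_zero]
  simp

end SurfaceMap

/-! ### Euler characteristic -/

namespace Equiv.Perm

variable {D : Type*} [Fintype D]

/-- A cycle of a permutation is either a nontrivial cycle factor or a fixed point. -/
noncomputable def orbitsEquiv [DecidableEq D] (p : Equiv.Perm D) :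
    p.Orbits ≃ p.cycleFactorsFinset ⊕ Function.fixedPoints p :=
  Equiv.ofBijective
    (Quotient.lift (fun d => if h : p d = d then Sum.inr ⟨d, h⟩ else
      Sum.inl ⟨p.cycleOf d, cycleOf_mem_cycleFactorsFinset_iff.2 (mem_support.2 h)⟩) (by
        intro a b (hab : p.SameCycle a b)
        by_cases h : p a = a
        · obtain rfl : a = b := (hab.eq_of_left h)
          rfl
        · have h' : p b ≠ b := fun h' => h (by rw [hab.symm.eq_of_left h'] at h'; exact h')
          simp only [dif_neg h, dif_neg h', hab.cycleOf_eq])) (by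
    constructor
    · intro q q' h
      induction q using Quotient.inductionOn with
      | _ a =>
      induction q' using Quotient.inductionOn with
      | _ b =>
      simp only [Quotient.lift_mk] at h
      apply Quotient.sound
      split_ifs at h with h1 h2 h2
      · rw [show a = b from congrArg Subtype.val (Sum.inr_injective h)]
      · exact (sameCycle_iff_cycleOf_eq_of_mem_support (mem_support.2 h1) (mem_support.2 h2)).2
          (congrArg Subtype.val (Sum.inl_injective h))
    · rintro (⟨c, hc⟩ | ⟨d, hd⟩)
      · obtain ⟨x, hx⟩ := IsCycle.nonempty_support (mem_cycleFactorsFinset_iff.mp hc).1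
        have h : p x ≠ x := mem_support.1 (mem_cycleFactorsFinset_support_le hc hx)
        refine ⟨Quotient.mk _ x, ?_⟩
        simp only [Quotient.lift_mk, dif_neg h]
        exact congrArg Sum.inl (Subtype.ext (cycle_is_cycleOf hx hc).symm)
      · exact ⟨Quotient.mk _ d, dif_pos hd⟩)

theorem sign_eq_neg_one_pow_card_orbits [DecidableEq D] (p : Equiv.Perm D) :
    sign p = (-1) ^ (Fintype.card D + Nat.card p.Orbits) := by
  classical
  have h1 := sign_of_cycleType p
  have h2 := p.sum_cycleType_le
  have h3 : Nat.card p.Orbits = Multiset.card p.cycleType + (Fintype.card D - p.cycleType.sum) := by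
    rw [Nat.card_congr p.orbitsEquiv, Nat.card_sum, Nat.card_eq_fintype_card,
      Nat.card_eq_fintype_card, card_fixedPoints, cycleType_def, Multiset.card_map,
      Fintype.card_coe]
    rfl
  obtain ⟨k, hk⟩ := Nat.exists_eq_add_of_le h2
  rw [h1, h3, show Fintype.card D + (Multiset.card p.cycleType + (Fintype.card D - p.cycleType.sum)) =
    p.cycleType.sum + Multiset.card p.cycleType + 2 * k by omega, pow_add _ _ (2 * k), pow_mul]
  simp

/-- Compare signs in $\mathrm{sign}(r^{-1}\tau)=\mathrm{sign}(r)\,\mathrm{sign}(\tau)$: each sign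
records the parity of a number of orbits, and the fixed-point-free involution `τ` has sign $(-1)^m$.
-/
theorem even_card_orbits_add [DecidableEq D] (r τ : Equiv.Perm D) {m : ℕ}
    (hτ : ∀ d, τ (τ d) = d) (hτ' : ∀ d, τ d ≠ d) (hm : Fintype.card D = 2 * m) :
    Even (Nat.card r.Orbits + m + Nat.card (r⁻¹ * τ).Orbits) := by
  have h1 : sign τ = (-1) ^ m := by
    rw [sign_of_pow_two_eq_one (by ext d; simp [pow_two, hτ])]
    have : IsEmpty (Function.fixedPoints τ) := ⟨fun d => hτ' d d.2⟩
    simp [hm]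
  have h2 := sign_eq_neg_one_pow_card_orbits (r⁻¹ * τ)
  rw [sign_mul, sign_inv, h1, sign_eq_neg_one_pow_card_orbits r, hm] at h2
  rw [pow_add, pow_add, pow_mul] at h2
  have h3 : ((-1 : ℤˣ)) ^ (Nat.card r.Orbits + m + Nat.card (r⁻¹ * τ).Orbits) = 1 := by
    simp at h2
    rw [pow_add, pow_add, h2, ← pow_add, Even.neg_one_pow ⟨_, rfl⟩]
  by_contra h
  rw [Nat.not_even_iff_odd] at h
  rw [h.neg_one_pow] at h3
  exact absurd h3 (by decide)

/-- Euler's inequality $v+f\le e+2$ by linear algebra: functions on vertices, faces and edges embed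
into functions on darts plus two scalars, so $v+f+e\le 2e+2$. The scalars record values at `d₀`,
which removes the constants; injectivity rests on the orthogonality of primal and dual gradients. -/
theorem card_orbits_add_le (r τ : Equiv.Perm D) {I : Type*} [Fintype I] (ε : D → I)
    (hτ : ∀ d, τ (τ d) = d) (hε : ∀ d, ε (τ d) = ε d) (hε' : Function.Surjective ε)
    (hI : Fintype.card D = 2 * Fintype.card I) (d₀ : D)
    (hconn : ∀ u : D → ℚ, (∀ d, u (r d) = u d) → (∀ d, u (τ d) = u d) → ∀ d, u d = u d₀) :
    Nat.card r.Orbits + Nat.card (r⁻¹ * τ).Orbits ≤ Fintype.card I + 2 := by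
  classical
  let Ψ : ((r.Orbits → ℚ) × ((r⁻¹ * τ).Orbits → ℚ) × (I → ℚ)) →ₗ[ℚ] (D → ℚ) × ℚ × ℚ :=
    { toFun := fun x => (fun d => x.1 (Quotient.mk _ (τ d)) - x.1 (Quotient.mk _ d) +
          (x.2.1 (Quotient.mk _ d) - x.2.1 (Quotient.mk _ (τ d))) + x.2.2 (ε d),
        x.1 (Quotient.mk _ d₀), x.2.1 (Quotient.mk _ d₀))
      map_add' := fun x y => by
        ext <;> simp
        ring
      map_smul' := fun c x => by
        ext <;> simp
        ring }
  have hΨ : Function.Injective Ψ := by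
    rw [injective_iff_map_eq_zero]
    rintro ⟨u, h, s⟩ hx
    have h1 : ∀ d, u (Quotient.mk _ (τ d)) - u (Quotient.mk _ d) +
        (h (Quotient.mk _ d) - h (Quotient.mk _ (τ d))) + s (ε d) = 0 :=
      fun d => congrFun (congrArg Prod.fst hx) d
    have hu₀ : u (Quotient.mk _ d₀) = 0 := congrArg (fun z => z.2.1) hx
    have hh₀ : h (Quotient.mk _ d₀) = 0 := congrArg (fun z => z.2.2) hx
    -- The gradient terms change sign under `τ` while the edge term does not, so the two parts
    -- vanish separately.
    have hs : s = 0 := by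
      ext i
      obtain ⟨d, rfl⟩ := hε' i
      have h2 := h1 (τ d)
      rw [hτ, hε] at h2
      have := h1 d
      simp only [Pi.zero_apply]
      linarith
    subst hs
    set U : D → ℚ := fun d => u (Quotient.mk _ d) with hU
    set H : D → ℚ := fun d => h (Quotient.mk _ d) with hH
    have hUr : ∀ d, U (r d) = U d := fun d => congrArg u (Quotient.sound
      ((sameCycle_apply_left).2 (SameCycle.refl r d)))
    have hHφ : ∀ d, H (r⁻¹ (τ d)) = H d := fun d => congrArg h (Quotient.sound
      ((sameCycle_apply_left (f := r⁻¹ * τ)).2 (SameCycle.refl _ d)))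
    have hUr' : ∀ d, U (r⁻¹ d) = U d := fun d => by
      rw [← hUr (r⁻¹ d), coe_inv, Equiv.apply_symm_apply]
    have h2 : ∀ d, U (τ d) - U d = H (τ d) - H d := fun d => by
      have := h1 d
      simp only [Pi.zero_apply] at this
      simp only [hU, hH]
      linarith
    -- The primal and dual gradients agree by `h2`, and they are orthogonal: invariance of `U` under
    -- `r` and of `H` under `r⁻¹ * τ` makes all four sums in the expanded product equal. Hence both
    -- gradients are zero.
    have h3 : ∑ d, (U (τ d) - U d) ^ 2 = 0 := by
      have e1 : ∑ d, U (τ d) * H (τ d) = ∑ d, U d * H d := Equiv.sum_comp τ fun d => U d * H d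
      have e2 : ∑ d, U (τ d) * H d = ∑ d, U d * H d := by
        rw [← Equiv.sum_comp (r⁻¹ * τ) fun d => U d * H d]
        exact Finset.sum_congr rfl fun d _ => by
          rw [mul_apply, hHφ, hUr']
      have e3 : ∑ d, U d * H (τ d) = ∑ d, U d * H d := by
        rw [← e2, ← Equiv.sum_comp τ fun d => U (τ d) * H d]
        exact Finset.sum_congr rfl fun d _ => by rw [hτ]
      calc ∑ d, (U (τ d) - U d) ^ 2 = ∑ d, (U (τ d) - U d) * (H (τ d) - H d) :=
            Finset.sum_congr rfl fun d _ => by rw [← h2, pow_two]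
        _ = ∑ d, U (τ d) * H (τ d) - ∑ d, U (τ d) * H d - ∑ d, U d * H (τ d) + ∑ d, U d * H d := by
          rw [← Finset.sum_sub_distrib, ← Finset.sum_sub_distrib, ← Finset.sum_add_distrib]
          exact Finset.sum_congr rfl fun d _ => by ring
        _ = 0 := by rw [e1, e2, e3]; ring
    have h4 : ∀ d, U (τ d) = U d := fun d => by
      have := (Finset.sum_eq_zero_iff_of_nonneg fun d _ => sq_nonneg (U (τ d) - U d)).1 h3 d
        (Finset.mem_univ d)
      exact sub_eq_zero.1 (pow_eq_zero_iff two_ne_zero |>.1 this)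
    have h5 : ∀ d, H (τ d) = H d := fun d => by
      have := h2 d
      rw [h4] at this
      linarith
    have h6 : ∀ d, H (r d) = H d := fun d => by
      have := hHφ (τ (r d))
      rw [hτ, coe_inv, Equiv.symm_apply_apply, h5] at this
      exact this.symm
    have hu : u = 0 := by
      ext q
      induction q using Quotient.inductionOn with
      | _ d => exact (hconn U hUr h4 d).trans hu₀
    have hh : h = 0 := by
      ext q
      induction q using Quotient.inductionOn with
      | _ d => exact (hconn H h6 h5 d).trans hh₀
    rw [hu, hh]
    rfl
  have := LinearMap.finrank_le_finrank_of_injective hΨ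
  simp only [Module.finrank_prod, Module.finrank_fintype_fun_eq_card, Module.finrank_self, hI] at this
  rw [Nat.card_eq_fintype_card, Nat.card_eq_fintype_card]
  omega

end Equiv.Perm

/-! ### Parity and bound of the Euler characteristic of a component -/

namespace SurfaceMap

variable {V E : Type*} (M : SurfaceMap V E)

theorem comp_vert_rot (d : E × Bool) : M.comp (M.vert (M.rot d)) = M.comp (M.vert d) := by
  rw [vert_rot]

theorem comp_vert_fst (d : E × Bool) : M.comp (M.vert (d.1, true)) = M.comp (M.vert d) := by
  obtain ⟨e, _ | _⟩ := d
  · exact M.comp_vert_dartFlip (e, false)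
  · rfl

theorem comp_eq_comp_iff_of_isolated {v : V} (hv : ∀ d, M.vert d ≠ v) (u : V) :
    M.comp u = M.comp v ↔ u = v := by
  refine ⟨fun h => ?_, fun h => by rw [h]⟩
  let s : M.Component → Prop := Quot.lift (fun u => u = v) (by
    rintro _ _ ⟨e, rfl, rfl⟩
    simp [hv])
  have h1 : s (M.comp u) = s (M.comp v) := congrArg s h
  exact (iff_of_eq h1).2 rfl

/-- Invariance under rotation and flip gives invariance under face tracing, so `u` defines a
function on faces that factors through components. Its value at isolated vertices is immaterial. -/
theorem eq_of_comp_vert_eq {ι : Type*} (u : E × Bool → ι) (hrot : ∀ d, u (M.rot d) = u d)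
    (hflip : ∀ d, u (dartFlip E d) = u d) {d d' : E × Bool}
    (h : M.comp (M.vert d) = M.comp (M.vert d')) : u d = u d' := by
  have hface : ∀ d, u (M.faceRot d) = u d := by
    intro d
    rw [← hrot, ← hflip d]
    congr 1
    simp [faceRot]
  let t : M.Face → ι := Sum.elim (Quotient.lift u (by
    rintro a b ⟨k, rfl⟩
    induction k using Int.induction_on with
    | zero => rfl
    | succ k ih => rw [add_comm, zpow_add, zpow_one, Equiv.Perm.mul_apply, hface, ih]
    | pred k ih =>
      rw [ih, ← hface ((M.faceRot ^ (-(k : ℤ) - 1)) a), ← Equiv.Perm.mul_apply, ← zpow_one_add,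
        add_sub_cancel])) (fun _ => u d)
  obtain ⟨c, hc⟩ := (M.exists_component_function_iff t).2 (by
    intro d
    change u d = u (M.rot⁻¹ d)
    rw [← hrot (M.rot⁻¹ d), Equiv.Perm.coe_inv, Equiv.apply_symm_apply])
  exact (hc (Sum.inl (Quotient.mk _ d))).trans
    ((congrArg c h).trans (hc (Sum.inl (Quotient.mk _ d'))).symm)

/-- The darts in a connected component. -/
abbrev ComponentDart (C : M.Component) : Type _ := {d : E × Bool // M.comp (M.vert d) = C}

/-- The rotations around the vertices of a connected component. -/
def componentRot (C : M.Component) : Equiv.Perm (M.ComponentDart C) :=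
  M.rot.subtypePerm fun d => by rw [comp_vert_rot]

/-- The involution on the darts of a connected component. -/
def componentFlip (C : M.Component) : Equiv.Perm (M.ComponentDart C) :=
  (dartFlip E).subtypePerm fun d => by rw [comp_vert_dartFlip]

theorem componentRot_inv_mul_componentFlip (C : M.Component) :
    (M.componentRot C)⁻¹ * M.componentFlip C =
      M.faceRot.subtypePerm (p := fun d => M.comp (M.vert d) = C)
        (fun d => by rw [comp_vert_faceRot]) := by
  ext d : 2
  rfl

variable {M} in
theorem exists_vert_eq {C : M.Component} (d : M.ComponentDart C) {v : V} (hv : M.comp v = C) :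
    ∃ d', M.vert d' = v := by
  by_contra h
  push Not at h
  exact h d.1 ((M.comp_eq_comp_iff_of_isolated h _).1 (d.2.trans hv.symm))

theorem card_orbits_componentRot {C : M.Component} [Fintype (M.ComponentDart C)]
    (d₀ : M.ComponentDart C) :
    Nat.card (M.componentRot C).Orbits = Nat.card {v : V // M.comp v = C} := by
  refine Nat.card_congr (Equiv.ofBijective (Quotient.lift
    (fun d : M.ComponentDart C => (⟨M.vert d.1, d.2⟩ : {v : V // M.comp v = C})) ?_) ⟨?_, ?_⟩)
  · intro a b hab
    exact Subtype.ext ((M.vert_eq_iff _ _).2 (Equiv.Perm.sameCycle_subtypePerm.1 hab))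
  · intro q q' h
    induction q using Quotient.inductionOn with
    | _ a =>
    induction q' using Quotient.inductionOn with
    | _ b =>
    exact Quotient.sound (Equiv.Perm.sameCycle_subtypePerm.2
      ((M.vert_eq_iff _ _).1 (congrArg Subtype.val h)))
  · rintro ⟨v, hv⟩
    obtain ⟨d, rfl⟩ := exists_vert_eq d₀ hv
    exact ⟨Quotient.mk _ ⟨d, hv⟩, rfl⟩

theorem card_orbits_componentFace {C : M.Component} [Fintype (M.ComponentDart C)]
    (d₀ : M.ComponentDart C) :
    Nat.card ((M.componentRot C)⁻¹ * M.componentFlip C).Orbits =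
      Nat.card {F : M.Face // M.faceComp F = C} := by
  rw [componentRot_inv_mul_componentFlip]
  refine Nat.card_congr (Equiv.ofBijective (Quotient.lift
    (fun d : M.ComponentDart C =>
      (⟨Sum.inl (Quotient.mk _ d.1), d.2⟩ : {F : M.Face // M.faceComp F = C})) ?_) ⟨?_, ?_⟩)
  · intro a b hab
    exact Subtype.ext (congrArg Sum.inl (Quotient.sound (Equiv.Perm.sameCycle_subtypePerm.1 hab)))
  · intro q q' h
    induction q using Quotient.inductionOn with
    | _ a =>
    induction q' using Quotient.inductionOn with
    | _ b =>
    exact Quotient.sound (Equiv.Perm.sameCycle_subtypePerm.2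
      (Quotient.exact (s := Equiv.Perm.SameCycle.setoid M.faceRot)
        (Sum.inl_injective (congrArg Subtype.val h))))
  · rintro ⟨q | v, h⟩
    · induction q using Quotient.inductionOn with
      | _ d => exact ⟨Quotient.mk _ ⟨d, h⟩, rfl⟩
    · obtain ⟨d, hd⟩ := exists_vert_eq d₀ h
      exact absurd hd (v.2 d)

/-- The darts of a connected component are the pairs of an edge of it and a direction. -/
def componentDartEquiv (C : M.Component) :
    {e : E // M.comp (M.vert (e, true)) = C} × Bool ≃ M.ComponentDart C where
  toFun x := ⟨(x.1.1, x.2), (M.comp_vert_fst (x.1.1, x.2)).symm.trans x.1.2⟩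
  invFun d := (⟨d.1.1, (M.comp_vert_fst d.1).trans d.2⟩, d.1.2)
  left_inv _ := rfl
  right_inv _ := rfl

theorem sum_card_fiber_component [Finite V] {α : Type*} [Finite α] (g : α → M.Component) :
    ∑ C, Nat.card {x // g x = C} = Nat.card α := by
  rw [← Nat.card_sigma]
  exact Nat.card_congr (Equiv.sigmaFiberEquiv g)

theorem card_faces_pos (C : M.Component) [Finite V] [Finite E] :
    0 < Nat.card {F : M.Face // M.faceComp F = C} := by
  obtain ⟨F, hF⟩ := M.faceComp_surjective C
  exact Nat.card_pos_iff.2 ⟨⟨⟨F, hF⟩⟩, inferInstance⟩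

variable [Finite E]

/-- A component without darts is an isolated vertex, with $\chi=1-0+1$. Otherwise the two orbit
counts apply to the rotation and flip restricted to its darts. -/
theorem even_eulerChar_and_le (C : M.Component) : Even (M.eulerChar C) ∧ M.eulerChar C ≤ 2 := by
  classical
  have := Fintype.ofFinite E
  have := Fintype.ofFinite (M.ComponentDart C)
  have := Fintype.ofFinite {e : E // M.comp (M.vert (e, true)) = C}
  have hcard : Fintype.card (M.ComponentDart C) =
      2 * Fintype.card {e : E // M.comp (M.vert (e, true)) = C} := by
    rw [← Fintype.card_congr (M.componentDartEquiv C), Fintype.card_prod, Fintype.card_bool,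
      mul_comm]
  rcases isEmpty_or_nonempty (M.ComponentDart C) with hD | ⟨⟨d₀⟩⟩
  · obtain ⟨v, rfl⟩ := M.comp_surjective C
    have hv : ∀ d, M.vert d ≠ v := fun d hd => hD.false ⟨d, by rw [hd]⟩
    have h1 : Nat.card {u : V // M.comp u = M.comp v} = 1 := by
      simp [M.comp_eq_comp_iff_of_isolated hv]
    have h2 : Nat.card {e : E // M.comp (M.vert (e, true)) = M.comp v} = 0 := by
      have : IsEmpty {e : E // M.comp (M.vert (e, true)) = M.comp v} :=
        ⟨fun e => hD.false ⟨_, e.2⟩⟩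
      simp
    have h3 : Nat.card {F : M.Face // M.faceComp F = M.comp v} = 1 := by
      rw [Nat.card_eq_one_iff_unique]
      refine ⟨⟨?_⟩, ⟨Sum.inr ⟨v, hv⟩, rfl⟩⟩
      have key : ∀ F : M.Face, M.faceComp F = M.comp v → F = Sum.inr ⟨v, hv⟩ := by
        rintro (q | u) h
        · induction q using Quotient.inductionOn with
          | _ d => exact (hD.false ⟨d, h⟩).elim
        · exact congrArg Sum.inr (Subtype.ext ((M.comp_eq_comp_iff_of_isolated hv _).1 h))
      rintro ⟨F, hF⟩ ⟨F', hF'⟩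
      exact Subtype.ext ((key F hF).trans (key F' hF').symm)
    rw [eulerChar, h1, h2, h3]
    exact ⟨⟨1, by norm_num⟩, by norm_num⟩
  · have hflip : ∀ d, M.componentFlip C (M.componentFlip C d) = d := fun d =>
      Subtype.ext (dartFlip_dartFlip E d.1)
    have h1 := Equiv.Perm.even_card_orbits_add (M.componentRot C) (M.componentFlip C) hflip (by
      rintro ⟨⟨e, b⟩, hd⟩ h
      have h' := congrArg (fun d => d.1.2) h
      simp [componentFlip, dartFlip] at h') hcard
    have h2 := Equiv.Perm.card_orbits_add_le (M.componentRot C) (M.componentFlip C)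
      (fun d => ((M.componentDartEquiv C).symm d).1) hflip (fun d => rfl)
      (fun e => ⟨M.componentDartEquiv C (e, true), rfl⟩) hcard d₀ (by
        intro u hr hτ d
        -- Extension by zero keeps the invariance, because rotation and flip preserve components.
        let u' : E × Bool → ℚ := fun d => if h : M.comp (M.vert d) = C then u ⟨d, h⟩ else 0
        have hu' : ∀ d : M.ComponentDart C, u' d.1 = u d := fun d => dif_pos d.2
        rw [← hu', ← hu']
        refine M.eq_of_comp_vert_eq u' (fun d => ?_) (fun d => ?_) (d.2.trans d₀.2.symm)
        · by_cases h : M.comp (M.vert d) = C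
          · exact (hu' (M.componentRot C ⟨d, h⟩)).trans ((hr _).trans (hu' ⟨d, h⟩).symm)
          · simp only [u', comp_vert_rot, dif_neg h]
        · by_cases h : M.comp (M.vert d) = C
          · exact (hu' (M.componentFlip C ⟨d, h⟩)).trans ((hτ _).trans (hu' ⟨d, h⟩).symm)
          · simp only [u', comp_vert_dartFlip, dif_neg h])
    rw [M.card_orbits_componentRot d₀, M.card_orbits_componentFace d₀] at h1 h2
    rw [← Nat.card_eq_fintype_card] at h1 h2
    rw [eulerChar]
    constructor
    · rw [Int.even_iff]
      rw [Nat.even_iff] at h1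
      omega
    · omega

theorem two_sub_two_mul_genus (C : M.Component) : 2 - 2 * (M.genus C : ℤ) = M.eulerChar C := by
  obtain ⟨⟨k, hk⟩, hle⟩ := M.even_eulerChar_and_le C
  rw [genus]
  omega

variable [Finite V]

/-- In each component $\chi\le 2$ and $f\ge 1$ give $v\le e+1$. Thus the subtraction in `nullity` is
never truncated. -/
theorem numVertices_le : M.numVertices ≤ M.numEdges + M.numComponents := by
  rw [numVertices, ← M.sum_card_fiber_component M.comp, numEdges,
    ← M.sum_card_fiber_component fun e => M.comp (M.vert (e, true)), numComponents,
    Nat.card_eq_fintype_card, Fintype.card_eq_sum_ones, ← Finset.sum_add_distrib]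
  refine Finset.sum_le_sum fun C _ => ?_
  have h1 := (M.even_eulerChar_and_le C).2
  have h2 := M.card_faces_pos C
  rw [eulerChar] at h1
  omega

end SurfaceMap

/-! ### The surface dual -/

namespace SurfaceMap

variable {V E : Type*} (N : SurfaceMap V E)

/-- Faces meeting at a corner of `N` are joined by a dual edge, namely that of the dart `d` at the
corner: `N.rot⁻¹ d` and `dartFlip E d` lie on the same face. -/
theorem exists_dual_comp_eq :
    ∃ c : N.Component → N.dual.Component, ∀ F, N.dual.comp F = c (N.faceComp F) := by
  refine (N.exists_component_function_iff N.dual.comp).2 fun d => ?_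
  have h1 : (Sum.inl (Quotient.mk _ (N.rot⁻¹ d)) : N.Face) = N.dual.vert (dartFlip E d) := by
    refine congrArg Sum.inl (Quotient.sound ?_)
    refine (Equiv.Perm.sameCycle_apply_right (f := N.faceRot)).1 ?_
    rw [faceRot, Equiv.Perm.mul_apply, dartFlip_dartFlip]
  rw [h1, comp_vert_dartFlip]
  rfl

/-- The connected components of the dual of a map are those of the map. -/
noncomputable def dualComponentEquiv : N.dual.Component ≃ N.Component :=
  Equiv.ofBijective (Quot.lift N.faceComp (by
    rintro _ _ ⟨e, rfl, rfl⟩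
    exact N.comp_vert_dartFlip (e, false))) (by
    constructor
    · intro C C' h
      obtain ⟨F, rfl⟩ := N.dual.comp_surjective C
      obtain ⟨F', rfl⟩ := N.dual.comp_surjective C'
      obtain ⟨c, hc⟩ := N.exists_dual_comp_eq
      rw [hc, hc]
      exact congrArg c h
    · intro C
      obtain ⟨F, rfl⟩ := N.faceComp_surjective C
      exact ⟨N.dual.comp F, rfl⟩)

theorem dualComponentEquiv_comp (F : N.Face) :
    N.dualComponentEquiv (N.dual.comp F) = N.faceComp F := rfl

/-- The faces of the dual of a map are the vertices of the map. -/
noncomputable def dualFaceEquiv [Finite E] : N.dual.Face ≃ V :=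
  (Equiv.sumCongr
    (Quotient.congr (dartFlip E) (by
      intro a b
      -- Face tracing in the dual is the original rotation conjugated by the flip, so its cycles
      -- correspond to vertices.
      have h : N.dual.faceRot = (dartFlip E)⁻¹ * N.rot * dartFlip E := by
        change (N.rot⁻¹ * dartFlip E)⁻¹ * dartFlip E = _
        rw [mul_inv_rev, inv_inv]
      change N.dual.faceRot.SameCycle a b ↔ N.rot.SameCycle (dartFlip E a) (dartFlip E b)
      have h' := Equiv.Perm.sameCycle_conj (f := N.rot) (g := (dartFlip E)⁻¹) (x := a) (y := b)
      rwa [inv_inv, ← h] at h'))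
    (Equiv.ofBijective
      (fun v : {v : V // ∀ d, N.vert d ≠ v} =>
        (⟨Sum.inr v, fun _ => Sum.inl_ne_inr⟩ : {F : N.Face // ∀ d, N.dual.vert d ≠ F})) (by
        constructor
        · intro v v' h
          exact Sum.inr_injective (congrArg Subtype.val h)
        · rintro ⟨q | v, h⟩
          · induction q using Quotient.inductionOn with
            | _ d => exact absurd rfl (h d)
          · exact ⟨v, rfl⟩)).symm).trans N.vertexEquiv

theorem dualComponentEquiv_faceComp [Finite E] (F : N.dual.Face) :
    N.dualComponentEquiv (N.dual.faceComp F) = N.comp (N.dualFaceEquiv F) := by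
  rcases F with q | ⟨q | v, h⟩
  · induction q using Quotient.inductionOn with
    | _ d => exact (N.comp_vert_dartFlip d).symm
  · induction q using Quotient.inductionOn with
    | _ d => exact absurd rfl (h d)
  · have : N.dualFaceEquiv (Sum.inr ⟨Sum.inr v, h⟩) = v.1 := by
      change N.vertexEquiv (Sum.inr ((Equiv.ofBijective _ _).symm _)) = v.1
      exact congrArg (fun w => N.vertexEquiv (Sum.inr w)) (Equiv.ofBijective_symm_apply_apply _ _ v)
    rw [this]
    rfl

theorem genus_dual [Finite E] (C : N.dual.Component) :
    N.dual.genus C = N.genus (N.dualComponentEquiv C) := by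
  have h1 : Nat.card {F : N.dual.Face // N.dual.faceComp F = C} =
      Nat.card {v : V // N.comp v = N.dualComponentEquiv C} :=
    Nat.card_congr (N.dualFaceEquiv.subtypeEquiv fun F => by
      rw [← dualComponentEquiv_faceComp, N.dualComponentEquiv.injective.eq_iff])
  have h2 : Nat.card {F : N.Face // N.dual.comp F = C} =
      Nat.card {F : N.Face // N.faceComp F = N.dualComponentEquiv C} :=
    Nat.card_congr ((Equiv.refl _).subtypeEquiv fun F => by
      rw [Equiv.refl_apply, ← dualComponentEquiv_comp, N.dualComponentEquiv.injective.eq_iff])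
  have h3 : Nat.card {e : E // N.dual.comp (N.dual.vert (e, true)) = C} =
      Nat.card {e : E // N.comp (N.vert (e, true)) = N.dualComponentEquiv C} :=
    Nat.card_congr ((Equiv.refl _).subtypeEquiv fun e => by
      rw [Equiv.refl_apply, ← N.dualComponentEquiv.injective.eq_iff]
      rfl)
  rw [genus, genus, eulerChar, eulerChar, h1, h2, h3]
  congr 3
  ring

theorem dualNullity_dual [Finite E] : N.dual.dualNullity = N.nullity := by
  rw [dualNullity, nullity, numComponents, numComponents, numFaces, numVertices,
    Nat.card_congr N.dualComponentEquiv, Nat.card_congr N.dualFaceEquiv]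
  rfl

/-! ### Evaluations of the surface Tutte polynomial -/

theorem numNowhereIdentityFlows_eq [Finite V] [Fintype E] {G : Type*} [Group G] [Finite G]
    (o : E → Bool) {ℓ : ℕ} {n : Fin ℓ → ℕ} {ρ : ∀ i, Representation ℂ G (Fin (n i) → ℂ)}
    (hρ : IsIrrepList G n ρ) :
    (N.numNowhereIdentityFlows o G : ℚ) =
      (-1) ^ ((N.numEdges : ℤ) - (N.numVertices : ℤ)) * ∑ B : Finset E,
        (-(Nat.card G : ℚ)) ^ (N.delete (B : Set E)).nullity *
          ∏ C : (N.delete (B : Set E)).Component,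
            (-(1 / (Nat.card G : ℚ)) *
              ∑ i, (n i : ℚ) ^ (2 - 2 * ((N.delete (B : Set E)).genus C : ℤ))) := by
  classical
  rw [N.numNowhereIdentityFlows_eq_sum, Finset.mul_sum]
  refine Finset.sum_congr rfl fun B _ => ?_
  have hq : (Nat.card G : ℚ) ≠ 0 := Nat.cast_ne_zero.mpr Nat.card_pos.ne'
  rw [card_isLocalFlow_eq_prod _ hρ, Finset.prod_mul_distrib, Finset.prod_const, Finset.card_univ,
    ← Nat.card_eq_fintype_card (α := Component _)]
  simp_rw [two_sub_two_mul_genus]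
  rw [← mul_assoc, ← mul_assoc, ← mul_assoc]
  congr 1
  set M' := N.delete (B : Set E)
  have he : (M'.numEdges : ℤ) = N.numEdges - B.card := by
    have h1 : M'.numEdges + B.card = N.numEdges := by
      have := Fintype.card_subtype_compl (fun e => e ∈ (B : Set E))
      have hle := Finset.card_le_univ B
      simp only [numEdges, Nat.card_eq_fintype_card]
      simp only [Finset.mem_coe, Fintype.card_coe] at this ⊢
      omega
    omega
  have hv : M'.numVertices = N.numVertices := rfl
  have hnull : (M'.nullity : ℤ) = M'.numEdges + M'.numComponents - M'.numVertices := by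
    have := M'.numVertices_le
    rw [nullity]
    omega
  have hneg : (-(Nat.card G : ℚ)) ≠ 0 := neg_ne_zero.2 hq
  have h1 : -(1 / (Nat.card G : ℚ)) = (-(Nat.card G : ℚ))⁻¹ := by
    rw [one_div, neg_inv]
  -- The inverse factors, one per component, cancel the component count in the nullity, leaving
  -- exponent $e-|B|-v$ on $-|G|$; its sign times $(-1)^{e-v}$ is $(-1)^{|B|}$.
  rw [h1, inv_pow, ← zpow_natCast (-(Nat.card G : ℚ)), ← zpow_natCast (-(Nat.card G : ℚ)), hnull,
    mul_assoc ((-1 : ℚ) ^ _), ← zpow_neg, ← zpow_add₀ hneg, hv, he, numComponents,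
    show (N.numEdges : ℤ) - B.card + (Nat.card M'.Component : ℕ) - N.numVertices +
      -(Nat.card M'.Component : ℕ) = N.numEdges - N.numVertices + -(B.card : ℤ) by ring,
    show (N.numEdges : ℤ) - B.card - N.numVertices = N.numEdges - N.numVertices + -(B.card : ℤ) by
      ring, neg_eq_neg_one_mul (Nat.card G : ℚ), mul_zpow, ← mul_assoc]
  congr 1
  rw [zpow_add₀ (by norm_num), ← mul_assoc, ← mul_zpow, zpow_neg, zpow_natCast, ← inv_pow]
  norm_num

end SurfaceMap

theorem mainTheorem1 {V E G : Type*} [Finite V] [Fintype E] [Group G] [Finite G]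
    (M : SurfaceMap V E) (o : E → Bool)
    {ℓ : ℕ} (n : Fin ℓ → ℕ) (ρ : ∀ i, Representation ℂ G (Fin (n i) → ℂ))
    (hρ : IsIrrepList G n ρ) :
    (M.numNowhereIdentityTensions o G : ℚ) =
        (-1) ^ ((M.numEdges : ℤ) - (M.numFaces : ℤ)) *
          MvPolynomial.aeval
            (tuttePoint (-(Nat.card G : ℚ)) 1
              (fun g => -(1 / (Nat.card G : ℚ)) * ∑ i, (n i : ℚ) ^ (2 - 2 * (g : ℤ)))
              (fun _ => 1))
            M.surfaceTutte ∧
      (M.numNowhereIdentityFlows o G : ℚ) =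
        (-1) ^ ((M.numEdges : ℤ) - (M.numVertices : ℤ)) *
          MvPolynomial.aeval
            (tuttePoint 1 (-(Nat.card G : ℚ))
              (fun _ => 1)
              (fun g => -(1 / (Nat.card G : ℚ)) * ∑ i, (n i : ℚ) ^ (2 - 2 * (g : ℤ))))
            M.surfaceTutte := by
  classical
  constructor
  -- The rotation of `M.dual` is `M.faceRot`, so local tensions of `M` are local flows of `M.dual`
  -- by definition. Here `B` is `A` itself, since `M.contract A` is the dual of `M.dual.delete A`.
  · refine (M.dual.numNowhereIdentityFlows_eq o hρ).trans ?_
    congr 1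
    simp only [SurfaceMap.surfaceTutte, map_sum, map_mul, map_pow, map_prod, MvPolynomial.aeval_X,
      tuttePoint, one_pow, Finset.prod_const_one, mul_one]
    refine Finset.sum_congr rfl fun A _ => ?_
    rw [SurfaceMap.contract, SurfaceMap.dualNullity_dual]
    congr 1
    rw [← (M.dual.delete (A : Set E)).dualComponentEquiv.prod_comp]
    exact Finset.prod_congr rfl fun C _ => by rw [SurfaceMap.genus_dual]
  · refine (M.numNowhereIdentityFlows_eq o hρ).trans ?_
    congr 1
    simp only [SurfaceMap.surfaceTutte, map_sum, map_mul, map_pow, map_prod, MvPolynomial.aeval_X,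
      tuttePoint, one_pow, Finset.prod_const_one, mul_one, one_mul]
    -- Inclusion and exclusion deletes `B`, whereas the polynomial deletes the complement of `A`.
    refine Fintype.sum_equiv (compl_involutive.toPerm compl) _ _ fun B => ?_
    rw [Function.Involutive.coe_toPerm, Finset.coe_compl, compl_compl]
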